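/- Fix $0<\alpha\le 1$, $L\ge 0$, $\delta>0$. Let $\mathcal C(\alpha,L,\delta,k)$ be the set of $f:[0,1]^k\to\mathbb R$ with $|f(u)-f(u')|\le L\|u-u'\|_2^{\alpha}$ whenever $\|u-u'\|_2\le\delta$. Let $1\le k\le d$, $d\ge 2$, and let $S\ge 1$ be an integer known to the player. **Adversary.** Before play, an oblivious adversary fixes functions $g_t:[0,1]^k\to[0,1]$ in $\mathcal C(\alpha,L,\delta,k)$ and $k$-tuples $\mathbf i_t=(i_{1,t},\dots,i_{k,t})$ of distinct elements of $\{1,\dots,d\}$. The reward functions on $[0,1]^d$ are $r_t(\mathbf x)=g_t(x_{i_{1,t}},\dots,x_{i_{k,t}})$; after playing $\mathbf x_t$ the player sees only $r_t(\mathbf x_t)$. Over $n$ rounds the sequence is at most $S$-hard if $1+|\{1\le l<n:\mathbf i_l\ne\mathbf i_{l+1}\}|\le S$. The regret is $R(n)=\sum_{t=1}^n\mathbb E[r_t(\mathbf x^*)-r_t(\mathbf x_t)]$, where $\mathbf x^*\in\operatorname{argmax}_{\mathbf x\in[0,1]^d}\sum_{t=1}^n r_t(\mathbf x)$. **Partitions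 and strategies.** A family $\mathcal A$ of ordered partitions $(A_1,\dots,A_k)$ of $\{1,\dots,d\}$ (empty parts allowed) satisfies the partition assumption if for any $k$ distinct $i_1,\dots,i_k\in\{1,\dots,d\}$ some member of $\mathcal A$ has exactly one of them in each of its parts. For an integer $M\ge 1$ put $\mathcal P_M=\{\frac1M\sum_{j=1}^k c_j\chi_{A_j}: c_j\in\{1,\dots,M\},\ (A_1,\dots,A_k)\in\mathcal A\}$. **Exp3.S.** On $K$ arms, with parameters $\gamma\in[0,1]$ and $a\ge0$: start with weights $w_j=1$; in each round draw arm $j$ with probability $p_j=(1-\gamma)w_j/\sum_l w_l+\gamma/K$; if arm $i$ is drawn and gives reward $y$, replace $w_j$ by $w_j\exp(\gamma\hat x_j/K)+\frac{ea}{K}\sum_l w_l$, where $\hat x_i=y/p_i$ and $\hat x_j=0$ for $j\ne i$. Tuned to $T$ rounds it uses $a=1/T$ and $\gamma=\min\{1,\sqrt{K(S\log(KT)+e)/((e-1)T)}\}$. **Algorithms.** The *epoch algorithm* for $T$ rounds runs Exp3.S, tuned to $T$, on the arms $\mathcal P_M$ with $$M=\left\lceil\left(k^{\frac{\alpha-3}{2}}e^{-\frac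 k2}(S\log d)^{-\frac12}\sqrt{\tfrac{T}{\log T}}\right)^{\frac{2}{2\alpha+k}}\right\rceil$$ for $T\ge2$, and $M=1$ for $T=1$. The algorithm *CAB* (doubling trick) does not know the number $n$ of rounds: for $T=1,2,4,\dots$ it plays the rounds $t=T,\dots,2T-1$ with a fresh copy of the epoch algorithm for $T$ rounds. Put $$B(T)=T^{\frac{\alpha+k}{2\alpha+k}}(\log T)^{\frac{\alpha}{2\alpha+k}}k^{\frac{\alpha(k+6)}{2(2\alpha+k)}}(S\log d)^{\frac{\alpha}{2\alpha+k}}.$$ **Statement.** For every $c_0$ there is a constant $C>0$ depending only on $\alpha,L,\delta,c_0$ such that for all $k,d,S$ as above: 1. If $\lceil 2ke^k\log d\rceil$ maps $\{1,\dots,d\}\to\{1,\dots,k\}$ are drawn independently and uniformly at random, then with probability at least $1-d^{-k}$ the family $\mathcal A$ of the partitions into their fibres satisfies the partition assumption and $|\mathcal A|\le 3ke^k\log d$. 2. Let $\mathcal A$ be any nonempty family that satisfies the partition assumption, with $|\mathcal A|\le c_0ke^k\log d$. For all $T\ge2$ and every adversary that is at most $S$-hard over $T$ rounds, the regret of the epoch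 algorithm after $T$ rounds satisfies $R(T)\le C\,2^{k/2}B(T)$, and even $R(T)\le C\,B(T)$ if $T/\log T\ge k^{k+5}e^kS\log d$. 3. For such $\mathcal A$, for all $n\ge2$ and every adversary that is at most $S$-hard over $n$ rounds, the regret of CAB after $n$ rounds satisfies $R(n)\le C\,2^{k/2}B(n)$, and even $R(n)\le C\,B(n)$ if $n/\log n\ge k^{k+5}e^kS\log d$. -/

import Mathlib

open Finset

namespace ContinuumBandit

noncomputable section

/-! ## Reward functions -/

/-- The cube `[0,1]^ι`. -/
def cube (ι : Type) : Set (ι → ℝ) := {x | ∀ j, x j ∈ Set.Icc (0 : ℝ) 1}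

/-- Local uniform Hölder continuity on `[0,1]^k`, with constant `L`, exponent `α` and
restriction `δ`, with respect to the Euclidean norm: the class `C(α, L, δ, k)`. -/
def LocallyHolder (α L δ : ℝ) {k : ℕ} (f : (Fin k → ℝ) → ℝ) : Prop :=
  ∀ u ∈ cube (Fin k), ∀ v ∈ cube (Fin k),
    ‖(WithLp.toLp 2 (u - v) : EuclideanSpace ℝ (Fin k))‖ ≤ δ →
      |f u - f v| ≤ L * ‖(WithLp.toLp 2 (u - v) : EuclideanSpace ℝ (Fin k))‖ ^ α

/-- In each of the first `n` rounds, `g t` maps `[0,1]^k` to `[0,1]` and belongs to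
`C(α, L, δ, k)`. Rounds are numbered from `0`. -/
def Admissible (α L δ : ℝ) {k : ℕ} (n : ℕ) (g : ℕ → (Fin k → ℝ) → ℝ) : Prop :=
  ∀ t < n, (∀ u ∈ cube (Fin k), g t u ∈ Set.Icc (0 : ℝ) 1) ∧ LocallyHolder α L δ (g t)

/-- The reward `r_t(x) = g_t(x_{i_{1,t}}, …, x_{i_{k,t}})`, where `i t` is the tuple of `k`
distinct coordinates active in round `t`. -/
def reward {k d : ℕ} (g : ℕ → (Fin k → ℝ) → ℝ) (i : ℕ → (Fin k ↪ Fin d)) :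
    ℕ → (Fin d → ℝ) → ℝ :=
  fun t x => g t fun j => x (i t j)

open Classical in
/-- Hardness of the first `n` terms of a sequence: one plus the number of changes. -/
def hardness {B : Type} (b : ℕ → B) (n : ℕ) : ℕ :=
  1 + #{l ∈ range (n - 1) | b l ≠ b (l + 1)}

/-- `xs` is a point of `argmax_{x ∈ [0,1]^d} ∑_{t < n} r_t(x)`. -/
def IsOptimal {d : ℕ} (r : ℕ → (Fin d → ℝ) → ℝ) (n : ℕ) (xs : Fin d → ℝ) : Prop :=
  xs ∈ cube (Fin d) ∧
    ∀ y ∈ cube (Fin d), ∑ t ∈ range n, r t y ≤ ∑ t ∈ range n, r t xs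

/-! ## Randomized players and regret -/

/-- A randomized player: the past plays with the rewards received, in chronological order,
determine the distribution of the next play. -/
abbrev Policy (X : Type) := List (X × ℝ) → PMF X

/-- The law of the history of the first `t` rounds, against the fixed rewards `r`. -/
def historyLaw {X : Type} (π : Policy X) (r : ℕ → X → ℝ) : ℕ → PMF (List (X × ℝ))
  | 0 => PMF.pure []
  | t + 1 => (historyLaw π r t).bind fun h =>
      (π h).bind fun x => PMF.pure (h ++ [(x, r t x)])

/-- The law of the strategy played in round `t` (rounds are numbered from `0`). -/
def playLaw {X : Type} (π : Policy X) (r : ℕ → X → ℝ) (t : ℕ) : PMF X :=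
  (historyLaw π r t).bind π

/-- The regret `∑_{t < n} E[r_t(xs) - r_t(x_t)]` with respect to the strategy `xs`. All the
players below play in a finite set, so that the expectations are finite sums. -/
def regret {X : Type} (π : Policy X) (r : ℕ → X → ℝ) (n : ℕ) (xs : X) : ℝ :=
  ∑ t ∈ range n, ∑' x, (playLaw π r t x).toReal * (r t xs - r t x)

/-! ## The algorithm Exp3.S on a finite set `P` of arms -/

/-- Probability of arm `x` when the current weights are `w`. -/
def exp3Prob {X : Type} (P : Finset X) (γ : ℝ) (w : X → ℝ) (x : X) : ℝ :=
  (1 - γ) * (w x / ∑ j ∈ P, w j) + γ / (#P : ℝ)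

/-- Update of the weights after arm `o.1` was played and reward `o.2` received. -/
def exp3Step {X : Type} [DecidableEq X] (P : Finset X) (γ a : ℝ) (w : X → ℝ) (o : X × ℝ) :
    X → ℝ :=
  fun j => w j * Real.exp (γ * (if j = o.1 then o.2 / exp3Prob P γ w j else 0) / (#P : ℝ))
    + Real.exp 1 * a / (#P : ℝ) * ∑ l ∈ P, w l

/-- The weights after a given history; all of them are `1` at the start. -/
def exp3Weights {X : Type} [DecidableEq X] (P : Finset X) (γ a : ℝ) (h : List (X × ℝ)) :
    X → ℝ :=
  h.foldl (exp3Step P γ a) fun _ => 1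

theorem exp3Weights_pos {X : Type} [DecidableEq X] (P : Finset X) (γ a : ℝ) (ha : 0 ≤ a)
    (h : List (X × ℝ)) (x : X) : 0 < exp3Weights P γ a h x := by
  have key : ∀ (h : List (X × ℝ)) (w : X → ℝ), (∀ x, 0 < w x) →
      ∀ x, 0 < h.foldl (exp3Step P γ a) w x := by
    intro h
    induction h with
    | nil => intro w hw x; exact hw x
    | cons o h ih =>
      intro w hw x
      refine ih _ (fun y => ?_) x
      have h1 : 0 ≤ ∑ l ∈ P, w l := Finset.sum_nonneg fun l _ => (hw l).le
      have h2 := hw y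
      unfold exp3Step
      positivity
  exact key h _ (fun _ => one_pos) x

theorem exp3Prob_nonneg {X : Type} (P : Finset X) (γ : ℝ) (h0 : 0 ≤ γ) (h1 : γ ≤ 1)
    (w : X → ℝ) (hw : ∀ x, 0 < w x) (x : X) : 0 ≤ exp3Prob P γ w x := by
  have h2 : 0 ≤ ∑ l ∈ P, w l := Finset.sum_nonneg fun l _ => (hw l).le
  have h3 := (hw x).le
  have h4 : 0 ≤ 1 - γ := by linarith
  unfold exp3Prob
  positivity

theorem exp3Prob_sum {X : Type} (P : Finset X) (hP : P.Nonempty) (γ : ℝ)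
    (w : X → ℝ) (hw : ∀ x, 0 < w x) : ∑ x ∈ P, exp3Prob P γ w x = 1 := by
  have h2 : (∑ l ∈ P, w l) ≠ 0 := (Finset.sum_pos (fun l _ => hw l) hP).ne'
  have h3 : (#P : ℝ) ≠ 0 := by exact_mod_cast hP.card_pos.ne'
  unfold exp3Prob
  rw [Finset.sum_add_distrib, ← Finset.mul_sum, ← Finset.sum_div, div_self h2,
    Finset.sum_const, nsmul_eq_mul, mul_div_cancel₀ _ h3]
  ring

/-- Exp3.S with exploration rate `γ` and weight sharing parameter `a`. -/
def exp3S {X : Type} [DecidableEq X] (P : Finset X) (hP : P.Nonempty) (γ a : ℝ)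
    (h0 : 0 ≤ γ) (h1 : γ ≤ 1) (ha : 0 ≤ a) : Policy X := fun h =>
  PMF.ofFinset
    (fun x => if x ∈ P then ENNReal.ofReal (exp3Prob P γ (exp3Weights P γ a h) x) else 0) P
    (by
      rw [Finset.sum_congr rfl fun x hx => if_pos hx, ← ENNReal.ofReal_sum_of_nonneg,
        exp3Prob_sum P hP γ _ (exp3Weights_pos P γ a ha h), ENNReal.ofReal_one]
      exact fun x _ => exp3Prob_nonneg P γ h0 h1 _ (exp3Weights_pos P γ a ha h) x)
    (fun x hx => if_neg hx)

/-- The exploration rate `min {1, √(K (S log (K T) + e) / ((e - 1) T))}` for `K` arms, `T`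
rounds and comparison sequences of hardness at most `S`. -/
def exp3Rate (K S T : ℕ) : ℝ :=
  min 1 √((K : ℝ) * ((S : ℝ) * Real.log ((K : ℝ) * (T : ℝ)) + Real.exp 1)
    / ((Real.exp 1 - 1) * (T : ℝ)))

/-- Exp3.S tuned to `T` rounds and hardness `S`: the sharing parameter is `1 / T`. -/
def exp3STuned {X : Type} [DecidableEq X] (P : Finset X) (hP : P.Nonempty) (S T : ℕ) :
    Policy X :=
  exp3S P hP (exp3Rate #P S T) (1 / (T : ℝ)) (le_min zero_le_one (Real.sqrt_nonneg _))
    (min_le_left _ _) (by positivity)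

/-! ## Partitions, strategy sets and the algorithm CAB -/

/-- A partition of the `d` coordinates into `k` disjoint, possibly empty sets
`A_j = {l | h l = j}` is given by the map `h`. The family `A` satisfies the partition
assumption if for any `k` distinct coordinates some member of `A` has exactly one of them in
each of its `k` sets. -/
def PartitionAssumption {k d : ℕ} (A : Finset (Fin d → Fin k)) : Prop :=
  ∀ i : Fin k ↪ Fin d, ∃ h ∈ A, ∀ j : Fin k, ∃! l : Fin k, h (i l) = j

/-- The strategy set `P_M`: all points `(1 / M) ∑_j c_j χ_{A_j}` with integers
`1 ≤ c_j ≤ M` and `(A_1, …, A_k)` in the family. -/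
def strategySet {k d : ℕ} (A : Finset (Fin d → Fin k)) (M : ℕ) : Finset (Fin d → ℝ) :=
  (A ×ˢ Fintype.piFinset fun _ : Fin k => Finset.Icc 1 M).image
    fun q l => (q.2 (q.1 l) : ℝ) / (M : ℝ)

theorem strategySet_nonempty {k d : ℕ} {A : Finset (Fin d → Fin k)} (hA : A.Nonempty)
    {M : ℕ} (hM : 1 ≤ M) : (strategySet A M).Nonempty :=
  (hA.product (Fintype.piFinset_nonempty.2 fun _ => Finset.nonempty_Icc.2 hM)).image _

/-- The number `M` of grid values for an epoch of `T` rounds. For `T ≥ 2` the ceiling is at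
least `1`; for `T = 1`, where the formula is undefined, `M = 1`. -/
def gridSize (α : ℝ) (k d S T : ℕ) : ℕ :=
  max 1 ⌈((k : ℝ) ^ ((α - 3) / 2) * Real.exp (-(k : ℝ) / 2)
    * ((S : ℝ) * Real.log (d : ℝ)) ^ (-(1 / 2) : ℝ)
    * √((T : ℝ) / Real.log (T : ℝ))) ^ (2 / (2 * α + (k : ℝ)))⌉₊

/-- The player of one epoch of `T` rounds: Exp3.S on `P_M`. -/
def epochPolicy (α : ℝ) {k d : ℕ} (A : Finset (Fin d → Fin k)) (hA : A.Nonempty) (S T : ℕ) :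
    Policy (Fin d → ℝ) :=
  exp3STuned (strategySet A (gridSize α k d S T))
    (strategySet_nonempty hA (le_max_left _ _)) S T

/-- The algorithm CAB with Exp3.S as its subroutine (doubling trick): for `T = 1, 2, 4, …` the
rounds `T, …, 2 T - 1` (numbered from `1`) are played by a fresh copy of the player of an epoch
of `T` rounds, which sees only what happened in that epoch. -/
def cabPolicy (α : ℝ) {k d : ℕ} (A : Finset (Fin d → Fin k)) (hA : A.Nonempty) (S : ℕ) :
    Policy (Fin d → ℝ) := fun h =>
  let T := 2 ^ Nat.log 2 (h.length + 1)
  epochPolicy α A hA S T (h.drop (T - 1))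

/-- The number `⌈2 k e^k log d⌉` of partitions drawn in the random construction. -/
def familySize (k d : ℕ) : ℕ := ⌈2 * (k : ℝ) * Real.exp (k : ℝ) * Real.log (d : ℝ)⌉₊

/-- The bound `T^((α+k)/(2α+k)) (log T)^(α/(2α+k)) k^(α(k+6)/(2(2α+k))) (S log d)^(α/(2α+k))`. -/
def regretBound (α : ℝ) (k d S T : ℕ) : ℝ :=
  (T : ℝ) ^ ((α + k) / (2 * α + k)) * Real.log (T : ℝ) ^ (α / (2 * α + k))
    * (k : ℝ) ^ (α * (k + 6) / (2 * (2 * α + k)))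
    * ((S : ℝ) * Real.log (d : ℝ)) ^ (α / (2 * α + k))

/-- Against every oblivious adversary that plays `n` rounds with at most `S`-hard active tuples,
the regret of `π` is at most `B`. -/
def RegretAtMost (α L δ : ℝ) (k : ℕ) {d : ℕ} (S n : ℕ) (π : Policy (Fin d → ℝ)) (B : ℝ) :
    Prop :=
  ∀ (g : ℕ → (Fin k → ℝ) → ℝ) (i : ℕ → (Fin k ↪ Fin d)) (xs : Fin d → ℝ),
    Admissible α L δ n g → hardness i n ≤ S → IsOptimal (reward g i) n xs →
      regret π (reward g i) n xs ≤ B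

/-- `T` is large: `T / log T ≥ k^(k+5) e^k S log d`. -/
def IsLarge (k d S T : ℕ) : Prop :=
  (k : ℝ) ^ (k + 5) * Real.exp (k : ℝ) * ((S : ℝ) * Real.log (d : ℝ))
    ≤ (T : ℝ) / Real.log (T : ℝ)

end

end ContinuumBandit

/-! The regret splits into a discretization and an estimation error. The partition assumption gives,
for each tuple of active coordinates, an arm of `strategySet A M` within `1/M` of the optimum on
those coordinates (`exists_strategy_near`); Hölder continuity bounds the loss per round by a
constant times `(√k/M)^α`. This comparison arm depends only on the active tuple, so it switches no
more often than the tuple does, and Exp3.S competes with such a sequence at cost `O(√(K(S log(KT) +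
e)T))`, `K` being the number of arms.

The Exp3.S bound is a potential argument. The potential `deficit` is the logarithm of the total
weight minus that of the comparison arm's weight. In expectation, a round raises it by roughly `γ/K`
times (expected reward minus comparison reward) plus a small error, and a switch costs an extra
`log(K/a)`. Since it starts at `log K` and stays nonnegative, the regret is bounded.

Let `Y` be `gridReal`, the grid size before rounding. With `Y` in place of `M`, the discretization
error and `k` times the leading estimation term both equal `exp(kα/(2α+k))` times `regretBound`, up
to constants (`discretization_eq`, `estimation_eq`), and the exponential is at most `e`. Rounding
`Y` up costs a factor `(1 + 1/Y)^(k/2)`: at most `2^(k/2)` if `Y ≥ 1`, at most `e` if `Y ≥ k/2`,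
which holds on large time scales. If `Y < 1`, the trivial bound `T` suffices.

For CAB, `regretBound` at `2^m` is at most `(2^m/n)^(2/3)` times its value at `n`, so the epochs sum
geometrically. Of this decay, `(2^m/n)^(1/6)` suffices for summation; `(2^m/n)^(1/2)` cancels
`2^(k/2)` in epochs shorter than `n/2^k`, while the longer ones still have `Y ≥ k/2`.

For the random family, a map separates a given tuple with probability at least `k!/k^k ≥ e^(-k)`; a
union bound over at most `d^k` tuples finishes. -/

namespace ContinuumBandit

/-! ## Means under finitely supported laws -/

/-- The mean of `f` under the law `p`. -/
noncomputable def mean {X : Type} (p : PMF X) (f : X → ℝ) : ℝ := ∑' x, (p x).toReal * f x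

theorem mean_eq_sum {X : Type} {p : PMF X} {s : Finset X} (hs : p.support ⊆ s) (f : X → ℝ) :
    mean p f = ∑ x ∈ s, (p x).toReal * f x := by
  refine tsum_eq_sum fun x hx => ?_
  have : p x = 0 := by
    rw [PMF.apply_eq_zero_iff]
    exact fun h => hx (by exact_mod_cast hs h)
  simp [this]

theorem mean_const {X : Type} (p : PMF X) (c : ℝ) : mean p (fun _ => c) = c := by
  unfold mean
  rw [tsum_mul_right, ← ENNReal.tsum_toReal_eq fun a => p.apply_ne_top a, p.tsum_coe]
  simp

theorem mean_add {X : Type} {p : PMF X} (hp : p.support.Finite) (f g : X → ℝ) :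
    mean p (fun x => f x + g x) = mean p f + mean p g := by
  have hs : p.support ⊆ hp.toFinset := by simp
  simp only [mean_eq_sum hs, mul_add, sum_add_distrib]

theorem mean_sub {X : Type} {p : PMF X} (hp : p.support.Finite) (f g : X → ℝ) :
    mean p (fun x => f x - g x) = mean p f - mean p g := by
  have hs : p.support ⊆ hp.toFinset := by simp
  simp only [mean_eq_sum hs, mul_sub, sum_sub_distrib]

theorem mean_const_mul {X : Type} (p : PMF X) (c : ℝ) (f : X → ℝ) :
    mean p (fun x => c * f x) = c * mean p f := by
  unfold mean
  rw [← tsum_mul_left]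
  exact tsum_congr fun x => by ring

theorem mean_mono {X : Type} {p : PMF X} (hp : p.support.Finite) {f g : X → ℝ}
    (h : ∀ x ∈ p.support, f x ≤ g x) : mean p f ≤ mean p g := by
  have hs : p.support ⊆ hp.toFinset := by simp
  rw [mean_eq_sum hs, mean_eq_sum hs]
  exact sum_le_sum fun x hx =>
    mul_le_mul_of_nonneg_left (h x (by simpa using hx)) ENNReal.toReal_nonneg

theorem mean_nonneg {X : Type} {p : PMF X} {f : X → ℝ} (h : ∀ x ∈ p.support, 0 ≤ f x) :
    0 ≤ mean p f := by
  refine tsum_nonneg fun x => ?_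
  by_cases hx : x ∈ p.support
  · exact mul_nonneg ENNReal.toReal_nonneg (h x hx)
  · simp [(p.apply_eq_zero_iff x).2 hx]

theorem mean_pure {X : Type} (a : X) (f : X → ℝ) : mean (PMF.pure a) f = f a := by
  have hs : (PMF.pure a).support ⊆ ({a} : Finset X) := by simp
  rw [mean_eq_sum hs]
  simp

theorem mean_bind {X Y : Type} {p : PMF X} {q : X → PMF Y} (hp : p.support.Finite)
    (hq : ∀ x, (q x).support.Finite) (f : Y → ℝ) :
    mean (p.bind q) f = mean p fun x => mean (q x) f := by
  have hs : p.support ⊆ hp.toFinset := by simp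
  rw [mean_eq_sum hs]
  have hb : ∀ y, ((p.bind q) y).toReal * f y
      = ∑ x ∈ hp.toFinset, (p x).toReal * ((q x y).toReal * f y) := by
    intro y
    rw [PMF.bind_apply, tsum_eq_sum (s := hp.toFinset), ENNReal.toReal_sum, sum_mul]
    · exact sum_congr rfl fun x _ => by rw [ENNReal.toReal_mul, mul_assoc]
    · exact fun x _ => ENNReal.mul_ne_top (p.apply_ne_top x) ((q x).apply_ne_top y)
    · intro x hx
      rw [(p.apply_eq_zero_iff x).2 (by simpa using hx), zero_mul]
  unfold mean
  rw [tsum_congr hb, Summable.tsum_finsetSum]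
  · exact sum_congr rfl fun x _ => tsum_mul_left
  · intro x _
    refine Summable.mul_left _ (summable_of_hasFiniteSupport ?_)
    refine (hq x).subset fun y hy => ?_
    rw [PMF.mem_support_iff]
    intro h0
    simp [h0] at hy

/-! ## Laws of histories and plays -/

theorem historyLaw_support_finite {X : Type} {π : Policy X} (hπ : ∀ h, (π h).support.Finite)
    (r : ℕ → X → ℝ) (t : ℕ) : (historyLaw π r t).support.Finite := by
  induction t with
  | zero => simp [historyLaw]
  | succ t ih =>
    rw [historyLaw, PMF.support_bind]
    refine ih.biUnion fun h _ => ?_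
    rw [PMF.support_bind]
    exact (hπ h).biUnion fun x _ => by simp

theorem length_of_mem_support_historyLaw {X : Type} {π : Policy X} {r : ℕ → X → ℝ} {t : ℕ}
    {h : List (X × ℝ)} (hh : h ∈ (historyLaw π r t).support) : h.length = t := by
  induction t generalizing h with
  | zero => simp_all [historyLaw]
  | succ t ih =>
    simp only [historyLaw, PMF.mem_support_bind_iff, PMF.mem_support_pure_iff] at hh
    obtain ⟨h', hh', x, _, rfl⟩ := hh
    simp [ih hh']

theorem mean_historyLaw_succ {X : Type} {π : Policy X} (hπ : ∀ h, (π h).support.Finite)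
    (r : ℕ → X → ℝ) (t : ℕ) (f : List (X × ℝ) → ℝ) :
    mean (historyLaw π r (t + 1)) f
      = mean (historyLaw π r t) fun h => mean (π h) fun x => f (h ++ [(x, r t x)]) := by
  rw [historyLaw, mean_bind (historyLaw_support_finite hπ r t)]
  · congr 1
    funext h
    rw [mean_bind (hπ h) (fun x => by simp)]
    simp only [mean_pure]
  · intro h
    rw [PMF.support_bind]
    exact (hπ h).biUnion fun x _ => by simp

theorem mean_playLaw {X : Type} {π : Policy X} (hπ : ∀ h, (π h).support.Finite)
    (r : ℕ → X → ℝ) (t : ℕ) (f : X → ℝ) :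
    mean (playLaw π r t) f = mean (historyLaw π r t) fun h => mean (π h) f :=
  mean_bind (historyLaw_support_finite hπ r t) hπ f

theorem bind_congr_of_support {X Y : Type} {p : PMF X} {f g : X → PMF Y}
    (h : ∀ x ∈ p.support, f x = g x) : p.bind f = p.bind g := by
  ext y
  rw [PMF.bind_apply, PMF.bind_apply]
  refine tsum_congr fun x => ?_
  by_cases hx : x ∈ p.support
  · rw [h x hx]
  · rw [(p.apply_eq_zero_iff x).2 hx, zero_mul, zero_mul]

/-- If `π` restarts the policy `ρ` after `N` rounds and runs it for `m` rounds, then the history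
from round `N` on is that of `ρ` against the shifted rewards. -/
theorem historyLaw_map_drop {X : Type} {π ρ : Policy X} {N m : ℕ}
    (hπ : ∀ h : List (X × ℝ), N ≤ h.length → h.length < N + m → π h = ρ (h.drop N))
    (r : ℕ → X → ℝ) {s : ℕ} (hs : s ≤ m) :
    (historyLaw π r (N + s)).map (List.drop N) = historyLaw ρ (fun t => r (N + t)) s := by
  induction s with
  | zero =>
    rw [PMF.map, Nat.add_zero, historyLaw,
      bind_congr_of_support (g := fun _ => PMF.pure []), PMF.bind_const]
    intro h hh
    rw [Function.comp_apply, List.drop_of_length_le (length_of_mem_support_historyLaw hh).le]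
  | succ s ih =>
    rw [← Nat.add_assoc, historyLaw, historyLaw, ← ih (by omega), PMF.map_bind, PMF.bind_map]
    refine bind_congr_of_support fun h hh => ?_
    have hl := length_of_mem_support_historyLaw hh
    rw [PMF.map_bind, hπ h (by omega) (by omega)]
    refine bind_congr_of_support fun x _ => ?_
    rw [PMF.pure_map, List.drop_append_of_le_length (by omega)]

theorem playLaw_add {X : Type} {π ρ : Policy X} {N m : ℕ}
    (hπ : ∀ h : List (X × ℝ), N ≤ h.length → h.length < N + m → π h = ρ (h.drop N))
    (r : ℕ → X → ℝ) {s : ℕ} (hs : s < m) :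
    playLaw π r (N + s) = playLaw ρ (fun t => r (N + t)) s := by
  rw [playLaw, playLaw, ← historyLaw_map_drop hπ r hs.le, PMF.bind_map]
  refine bind_congr_of_support fun h hh => ?_
  have hl := length_of_mem_support_historyLaw hh
  exact hπ h (by omega) (by omega)

/-! ## Regret of Exp3.S -/

section Exp3

variable {X : Type}

theorem exp3S_support_subset [DecidableEq X] (P : Finset X) (hP : P.Nonempty) (γ a : ℝ)
    (h0 : 0 ≤ γ) (h1 : γ ≤ 1) (ha : 0 ≤ a) (h : List (X × ℝ)) :
    (exp3S P hP γ a h0 h1 ha h).support ⊆ P := by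
  rw [exp3S, PMF.support_ofFinset]
  exact Set.inter_subset_left

theorem exp3S_support_finite [DecidableEq X] (P : Finset X) (hP : P.Nonempty) (γ a : ℝ)
    (h0 : 0 ≤ γ) (h1 : γ ≤ 1) (ha : 0 ≤ a) (h : List (X × ℝ)) :
    (exp3S P hP γ a h0 h1 ha h).support.Finite :=
  P.finite_toSet.subset (exp3S_support_subset P hP γ a h0 h1 ha h)

theorem mean_exp3S [DecidableEq X] (P : Finset X) (hP : P.Nonempty) (γ a : ℝ)
    (h0 : 0 ≤ γ) (h1 : γ ≤ 1) (ha : 0 ≤ a) (h : List (X × ℝ)) (f : X → ℝ) :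
    mean (exp3S P hP γ a h0 h1 ha h) f
      = ∑ x ∈ P, exp3Prob P γ (exp3Weights P γ a h) x * f x := by
  rw [mean_eq_sum (exp3S_support_subset P hP γ a h0 h1 ha h)]
  refine sum_congr rfl fun x hx => ?_
  rw [exp3S, PMF.ofFinset_apply, if_pos hx, ENNReal.toReal_ofReal]
  exact exp3Prob_nonneg P γ h0 h1 _ (exp3Weights_pos P γ a ha h) x

theorem playLaw_exp3STuned_support_subset [DecidableEq X] (P : Finset X) (hP : P.Nonempty)
    (S T : ℕ) (r : ℕ → X → ℝ) (t : ℕ) :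
    (playLaw (exp3STuned P hP S T) r t).support ⊆ P := by
  rw [playLaw, PMF.support_bind]
  exact Set.iUnion₂_subset fun h _ => exp3S_support_subset P hP _ _ _ _ _ h

variable {P : Finset X} {γ a : ℝ} {w : X → ℝ}

theorem exploration_le_exp3Prob (h1 : γ ≤ 1) (hw : ∀ x, 0 < w x) (x : X) :
    γ / (#P : ℝ) ≤ exp3Prob P γ w x := by
  have h2 : 0 ≤ ∑ l ∈ P, w l := sum_nonneg fun l _ => (hw l).le
  have h3 := (hw x).le
  have h4 : 0 ≤ 1 - γ := by linarith
  unfold exp3Prob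
  have : 0 ≤ (1 - γ) * (w x / ∑ j ∈ P, w j) := by positivity
  linarith

theorem exp3Prob_pos (hP : P.Nonempty) (h0 : 0 < γ) (h1 : γ ≤ 1) (hw : ∀ x, 0 < w x) (x : X) :
    0 < exp3Prob P γ w x :=
  lt_of_lt_of_le (div_pos h0 (by exact_mod_cast hP.card_pos)) (exploration_le_exp3Prob h1 hw x)

/-- Forced exploration keeps every probability above `γ/K`. The bound is used twice: for `e^z ≤ 1 +
z + z²`, and for `e^z ≤ e` when weight is shared. -/
theorem exponent_le_one (hP : P.Nonempty) (h0 : 0 < γ) (h1 : γ ≤ 1) (hw : ∀ x, 0 < w x) (x : X)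
    {y : ℝ} (hy1 : y ≤ 1) : γ * (y / exp3Prob P γ w x) / (#P : ℝ) ≤ 1 := by
  have hK : (0 : ℝ) < #P := by exact_mod_cast hP.card_pos
  have hp := exp3Prob_pos hP h0 h1 hw x
  have h2 := exploration_le_exp3Prob (P := P) h1 hw x
  rw [div_le_iff₀ hK] at h2
  rw [div_le_one hK, ← mul_div_assoc, div_le_iff₀ hp]
  nlinarith

theorem sum_exp3Step [DecidableEq X] (hP : P.Nonempty) {x : X} (hx : x ∈ P) (y : ℝ) :
    ∑ j ∈ P, exp3Step P γ a w (x, y) j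
      = (∑ j ∈ P, w j) + w x * (Real.exp (γ * (y / exp3Prob P γ w x) / (#P : ℝ)) - 1)
        + Real.exp 1 * a * ∑ j ∈ P, w j := by
  have hK : (#P : ℝ) ≠ 0 := by exact_mod_cast hP.card_pos.ne'
  have h1 : ∀ j ∈ P, w j * Real.exp (γ * (if j = x then y / exp3Prob P γ w j else 0) / (#P : ℝ))
      = w j + if j = x then
        w x * (Real.exp (γ * (y / exp3Prob P γ w x) / (#P : ℝ)) - 1) else 0 := by
    intro j _
    split_ifs with h
    · subst h; ring
    · simp
  unfold exp3Step
  rw [sum_add_distrib, sum_congr rfl h1, sum_add_distrib, sum_ite_eq' P x, if_pos hx, sum_const,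
    nsmul_eq_mul]
  field_simp

/-- Follows from `e^z ≤ 1 + z + z²`, `w x / W ≤ p / (1 - γ)` and `log (1 + u) ≤ u`. -/
theorem log_sum_exp3Step_le [DecidableEq X] (hP : P.Nonempty) (h0 : 0 < γ) (h1 : γ < 1)
    (ha : 0 ≤ a) (hw : ∀ x, 0 < w x) {x : X} (hx : x ∈ P) {y : ℝ} (hy0 : 0 ≤ y) (hy1 : y ≤ 1) :
    Real.log (∑ j ∈ P, exp3Step P γ a w (x, y) j)
      ≤ Real.log (∑ j ∈ P, w j) + (γ / #P / (1 - γ) * y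
        + (γ / #P) ^ 2 / (1 - γ) * (y / exp3Prob P γ w x) + Real.exp 1 * a) := by
  have hK : (0 : ℝ) < #P := by exact_mod_cast hP.card_pos
  have hW : 0 < ∑ j ∈ P, w j := sum_pos (fun l _ => hw l) hP
  have hp := exp3Prob_pos hP h0 h1.le hw x
  have hγ : 0 < 1 - γ := by linarith
  have hwx := hw x
  rw [sum_exp3Step hP hx]
  set W := ∑ j ∈ P, w j
  set p := exp3Prob P γ w x with hpdef
  set z := γ * (y / p) / (#P : ℝ) with hz
  have hz0 : 0 ≤ z := by positivity
  have hz1 : z ≤ 1 := exponent_le_one hP h0 h1.le hw x hy1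
  have hexp : Real.exp z - 1 ≤ z + z ^ 2 := by
    have := Real.abs_exp_sub_one_sub_id_le (x := z) (by rwa [abs_of_nonneg hz0])
    linarith [(abs_le.1 this).2]
  have hwp : w x ≤ W * (p / (1 - γ)) := by
    have : (1 - γ) * (w x / W) ≤ p := by
      have : 0 ≤ γ / (#P : ℝ) := by positivity
      rw [hpdef, exp3Prob]; linarith
    rw [← mul_div_assoc, le_div_iff₀ hγ]
    calc w x * (1 - γ) = W * ((1 - γ) * (w x / W)) := by field_simp
      _ ≤ W * p := by gcongr
  have hzp : p / (1 - γ) * (z + z ^ 2)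
      ≤ γ / #P / (1 - γ) * y + (γ / #P) ^ 2 / (1 - γ) * (y / p) := by
    have e1 : p / (1 - γ) * (z + z ^ 2)
        = γ / #P / (1 - γ) * y + (γ / #P) ^ 2 / (1 - γ) * (y / p) * y := by
      rw [hz]; field_simp
    rw [e1]
    have : 0 ≤ (γ / #P) ^ 2 / (1 - γ) * (y / p) := by positivity
    nlinarith
  set u := γ / #P / (1 - γ) * y + (γ / #P) ^ 2 / (1 - γ) * (y / p) + Real.exp 1 * a with hu
  have hu0 : 0 ≤ u := by positivity
  have hle : W + w x * (Real.exp z - 1) + Real.exp 1 * a * W ≤ W * (1 + u) := by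
    have : w x * (Real.exp z - 1) ≤ W * (p / (1 - γ)) * (z + z ^ 2) := by
      have : 0 ≤ Real.exp z - 1 := by linarith [Real.add_one_le_exp z]
      gcongr
    have h3 : W * (p / (1 - γ) * (z + z ^ 2))
        ≤ W * (γ / #P / (1 - γ) * y + (γ / #P) ^ 2 / (1 - γ) * (y / p)) := by gcongr
    rw [hu]; nlinarith
  have hpos : 0 < W + w x * (Real.exp z - 1) + Real.exp 1 * a * W := by
    have : 0 ≤ Real.exp z - 1 := by linarith [Real.add_one_le_exp z]
    positivity
  calc Real.log (W + w x * (Real.exp z - 1) + Real.exp 1 * a * W)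
      ≤ Real.log (W * (1 + u)) := Real.log_le_log hpos hle
    _ = Real.log W + Real.log (1 + u) := Real.log_mul hW.ne' (by positivity)
    _ ≤ Real.log W + u := by
      linarith [Real.log_le_sub_one_of_pos (show 0 < 1 + u by positivity)]

/-- If the comparison arm stays, the shared weight is discarded. If it switches, the new arm has
received at least `(e a / K) w j ≥ (a / K) e^z w j`: the factor `e` in the update preserves the gain
of the round, and only `log (K / a)` is lost. -/
theorem le_log_exp3Step [DecidableEq X] (hP : P.Nonempty) (h0 : 0 < γ) (h1 : γ ≤ 1)
    (ha : 0 < a) (hw : ∀ x, 0 < w x) {j j' : X} (hj : j ∈ P) (x : X) {y : ℝ} (hy1 : y ≤ 1) :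
    Real.log (w j) + γ / #P * (if j = x then y / exp3Prob P γ w j else 0)
        - (if j = j' then 0 else Real.log (#P / a))
      ≤ Real.log (exp3Step P γ a w (x, y) j') := by
  have hK : (0 : ℝ) < #P := by exact_mod_cast hP.card_pos
  have hW : 0 < ∑ j ∈ P, w j := sum_pos (fun l _ => hw l) hP
  have hwj := hw j
  have hz : γ * (if j = x then y / exp3Prob P γ w j else 0) / (#P : ℝ) ≤ 1 := by
    split_ifs with h
    · exact exponent_le_one hP h0 h1 hw j hy1
    · simp
  set z := γ * (if j = x then y / exp3Prob P γ w j else 0) / (#P : ℝ) with hzdef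
  have hzz : γ / #P * (if j = x then y / exp3Prob P γ w j else 0) = z := by rw [hzdef]; ring
  rw [hzz]
  by_cases hjj : j = j'
  · subst hjj
    rw [if_pos rfl]
    have : w j * Real.exp z ≤ exp3Step P γ a w (x, y) j := by
      unfold exp3Step
      have : 0 ≤ Real.exp 1 * a / (#P : ℝ) * ∑ l ∈ P, w l := by positivity
      simp only [← hzdef]
      linarith
    calc _ = Real.log (w j * Real.exp z) := by
          rw [Real.log_mul hwj.ne' (Real.exp_ne_zero z), Real.log_exp]; ring
      _ ≤ _ := Real.log_le_log (by positivity) this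
  · rw [if_neg hjj]
    have hle : a / #P * Real.exp z * w j ≤ exp3Step P γ a w (x, y) j' := by
      have e1 : Real.exp z ≤ Real.exp 1 := Real.exp_le_exp.2 hz
      have e2 : w j ≤ ∑ l ∈ P, w l := single_le_sum (fun l _ => (hw l).le) hj
      have e3 : a / #P * Real.exp z * w j ≤ a / #P * Real.exp 1 * ∑ l ∈ P, w l := by gcongr
      have e4 : a / #P * Real.exp 1 * ∑ l ∈ P, w l
          = Real.exp 1 * a / (#P : ℝ) * ∑ l ∈ P, w l := by ring
      have hwj' := hw j'
      unfold exp3Step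
      refine (e3.trans e4.le).trans (le_add_of_nonneg_left ?_)
      positivity
    calc _ = Real.log (a / #P * Real.exp z * w j) := by
          rw [Real.log_mul (by positivity) hwj.ne', Real.log_mul (by positivity)
            (Real.exp_ne_zero z), Real.log_exp, ← inv_div (#P : ℝ) a, Real.log_inv]
          ring
      _ ≤ _ := Real.log_le_log (by positivity) hle

/-- The logarithmic deficit of the weight of arm `j`. -/
noncomputable def deficit (P : Finset X) (w : X → ℝ) (j : X) : ℝ :=
  Real.log (∑ l ∈ P, w l) - Real.log (w j)

theorem deficit_nonneg (hw : ∀ x, 0 < w x) {j : X} (hj : j ∈ P) : 0 ≤ deficit P w j :=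
  sub_nonneg.2 (Real.log_le_log (hw j) (single_le_sum (fun l _ => (hw l).le) hj))

/-- Expected change of the deficit of a possibly changing comparison arm in one round. -/
theorem sum_deficit_exp3Step_le [DecidableEq X] (hP : P.Nonempty) (h0 : 0 < γ) (h1 : γ < 1)
    (ha : 0 < a) (hw : ∀ x, 0 < w x) {j j' : X} (hj : j ∈ P) {r : X → ℝ}
    (hr0 : ∀ x ∈ P, 0 ≤ r x) (hr1 : ∀ x ∈ P, r x ≤ 1) :
    ∑ x ∈ P, exp3Prob P γ w x * deficit P (exp3Step P γ a w (x, r x)) j'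
      ≤ deficit P w j + γ / #P / (1 - γ) * (∑ x ∈ P, exp3Prob P γ w x * r x)
        + (γ ^ 2 / #P / (1 - γ) + Real.exp 1 * a) - γ / #P * r j
        + (if j = j' then 0 else Real.log (#P / a)) := by
  have hK : (0 : ℝ) < #P := by exact_mod_cast hP.card_pos
  have hγ : 0 < 1 - γ := by linarith
  have hp := exp3Prob_pos hP h0 h1.le hw
  set p := exp3Prob P γ w
  set q := if j = j' then 0 else Real.log (#P / a)
  -- Multiplying by `p x` cancels the importance weight, which makes the reward estimate unbiased.
  -- The quadratic term becomes a plain sum of rewards, at most `K`.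
  have step : ∀ x ∈ P, p x * deficit P (exp3Step P γ a w (x, r x)) j'
      ≤ p x * (deficit P w j + Real.exp 1 * a + q) + γ / #P / (1 - γ) * (p x * r x)
        + (γ / #P) ^ 2 / (1 - γ) * r x - γ / #P * (if j = x then r j else 0) := by
    intro x hx
    have u1 := log_sum_exp3Step_le hP h0 h1 ha.le hw hx (hr0 x hx) (hr1 x hx)
    have u2 := le_log_exp3Step hP h0 h1.le ha hw hj (j' := j') x (hr1 x hx)
    have u3 : deficit P (exp3Step P γ a w (x, r x)) j'
        ≤ deficit P w j + Real.exp 1 * a + q + γ / #P / (1 - γ) * r x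
          + (γ / #P) ^ 2 / (1 - γ) * (r x / p x)
          - γ / #P * (if j = x then r x / p j else 0) := by
      unfold deficit
      linarith
    refine (mul_le_mul_of_nonneg_left u3 (hp x).le).trans (le_of_eq ?_)
    have hpx := (hp x).ne'
    split_ifs with h
    · subst h; field_simp
    · field_simp; ring
  refine (sum_le_sum step).trans ?_
  rw [sum_sub_distrib, sum_add_distrib, sum_add_distrib, ← sum_mul, exp3Prob_sum P hP γ w hw,
    ← mul_sum, ← mul_sum, ← mul_sum, sum_ite_eq P j, if_pos hj]
  have : (γ / #P) ^ 2 / (1 - γ) * ∑ x ∈ P, r x ≤ γ ^ 2 / #P / (1 - γ) := by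
    calc _ ≤ (γ / #P) ^ 2 / (1 - γ) * #P := by
          gcongr
          simpa using sum_le_sum hr1
      _ = _ := by field_simp
  linarith

theorem exp3Weights_append [DecidableEq X] (P : Finset X) (γ a : ℝ) (h : List (X × ℝ))
    (o : X × ℝ) : exp3Weights P γ a (h ++ [o]) = exp3Step P γ a (exp3Weights P γ a h) o := by
  simp [exp3Weights]

/-- The one-round estimate telescopes, starting from the deficit `log K` of uniform weights. -/
theorem mean_deficit_le [DecidableEq X] (hP : P.Nonempty) (h0 : 0 < γ) (h1 : γ < 1)
    (ha : 0 < a) {r : ℕ → X → ℝ} {b : ℕ → X} {n : ℕ} (hb : ∀ t, b t ∈ P)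
    (hr0 : ∀ t < n, ∀ x ∈ P, 0 ≤ r t x) (hr1 : ∀ t < n, ∀ x ∈ P, r t x ≤ 1) :
    mean (historyLaw (exp3S P hP γ a h0.le h1.le ha.le) r n)
        (fun h => deficit P (exp3Weights P γ a h) (b n))
      ≤ Real.log #P + γ / #P / (1 - γ)
          * (∑ t ∈ range n, mean (playLaw (exp3S P hP γ a h0.le h1.le ha.le) r t) (r t))
        + n * (γ ^ 2 / #P / (1 - γ) + Real.exp 1 * a) - γ / #P * ∑ t ∈ range n, r t (b t)
        + #{t ∈ range n | b t ≠ b (t + 1)} * Real.log (#P / a) := by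
  set π := exp3S P hP γ a h0.le h1.le ha.le with hπ
  have hfin : ∀ h, (π h).support.Finite := exp3S_support_finite P hP γ a h0.le h1.le ha.le
  induction n with
  | zero => simp [historyLaw, mean_pure, exp3Weights, deficit]
  | succ n ih =>
    have ih := ih (fun t ht => hr0 t (by omega)) (fun t ht => hr1 t (by omega))
    have hstep : mean (historyLaw π r (n + 1))
          (fun h => deficit P (exp3Weights P γ a h) (b (n + 1)))
        ≤ mean (historyLaw π r n) (fun h => deficit P (exp3Weights P γ a h) (b n)
          + (γ / #P / (1 - γ) * mean (π h) (r n) + ((γ ^ 2 / #P / (1 - γ) + Real.exp 1 * a)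
            - γ / #P * r n (b n)
            + (if b n = b (n + 1) then 0 else Real.log (#P / a))))) := by
      rw [mean_historyLaw_succ hfin]
      refine mean_mono (historyLaw_support_finite hfin r n) fun h _ => ?_
      rw [hπ, mean_exp3S, mean_exp3S]
      simp only [exp3Weights_append]
      have := sum_deficit_exp3Step_le hP h0 h1 ha (exp3Weights_pos P γ a ha.le h) (hb n)
        (j' := b (n + 1)) (hr0 n (by omega)) (hr1 n (by omega))
      linarith
    have hF := historyLaw_support_finite hfin r n
    rw [mean_add hF, mean_add hF, mean_const_mul, mean_const, ← mean_playLaw hfin] at hstep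
    rw [sum_range_succ, sum_range_succ, range_add_one, filter_insert]
    by_cases h2 : b n = b (n + 1)
    · rw [if_pos h2] at hstep
      rw [if_neg (by simpa using h2)]
      push_cast; linarith
    · rw [if_neg h2] at hstep
      rw [if_pos h2, card_insert_of_notMem (by simp)]
      push_cast; linarith

theorem sum_sub_mean_exp3S_le [DecidableEq X] (hP : P.Nonempty) (h0 : 0 < γ) (h1 : γ < 1)
    (ha : 0 < a) (ha1 : a ≤ 1) {r : ℕ → X → ℝ} {b : ℕ → X} {n S : ℕ} (hb : ∀ t, b t ∈ P)
    (hS : hardness b n ≤ S)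
    (hr0 : ∀ t < n, ∀ x ∈ P, 0 ≤ r t x) (hr1 : ∀ t < n, ∀ x ∈ P, r t x ≤ 1) :
    ∑ t ∈ range n,
        (r t (b t) - mean (playLaw (exp3S P hP γ a h0.le h1.le ha.le) r t) (r t))
      ≤ 2 * (γ * n) + #P / γ * (S * Real.log (#P / a) + n * (Real.exp 1 * a)) := by
  classical
  have hK : (0 : ℝ) < #P := by exact_mod_cast hP.card_pos
  have hK1 : (1 : ℝ) ≤ #P := by exact_mod_cast hP.card_pos
  have hγ : 0 < 1 - γ := by linarith
  have hlog : Real.log #P ≤ Real.log (#P / a) :=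
    Real.log_le_log hK (by rw [le_div_iff₀ ha]; nlinarith)
  have hlog0 : 0 ≤ Real.log #P := Real.log_nonneg hK1
  -- The telescoped bound also counts a switch after the last round, which `hardness` does not.
  -- Freezing the sequence at index `n - 1` removes it.
  set b' : ℕ → X := fun t => b (min t (n - 1)) with hb'
  have hbb : ∀ t ∈ range n, b' t = b t := fun t ht => by
    have : t < n := mem_range.1 ht
    simp only [hb']; congr 1; omega
  have main := mean_deficit_le hP h0 h1 ha (b := b') (fun t => hb _) hr0 hr1
  have hnn : 0 ≤ mean (historyLaw (exp3S P hP γ a h0.le h1.le ha.le) r n)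
        (fun h => deficit P (exp3Weights P γ a h) (b' n)) :=
    tsum_nonneg fun h => mul_nonneg ENNReal.toReal_nonneg
      (deficit_nonneg (exp3Weights_pos P γ a ha.le h) (hb _))
  have hcard : #{t ∈ range n | b' t ≠ b' (t + 1)} + 1 ≤ S := by
    refine le_trans ?_ hS
    rw [hardness, add_comm]
    gcongr 1 + ?_
    refine card_le_card fun t ht => ?_
    simp only [mem_filter, mem_range, hb'] at ht ⊢
    have hlt : t < n - 1 := by
      by_contra hge
      refine ht.2 ?_
      congr 1; omega
    refine ⟨hlt, ?_⟩
    have := ht.2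
    rwa [min_eq_left (by omega), min_eq_left (by omega)] at this
  have hcard' : (#{t ∈ range n | b' t ≠ b' (t + 1)} : ℝ) + 1 ≤ S := by exact_mod_cast hcard
  have hG : ∑ t ∈ range n, r t (b' t) = ∑ t ∈ range n, r t (b t) :=
    sum_congr rfl fun t ht => by rw [hbb t ht]
  rw [hG] at main
  have hGn : ∑ t ∈ range n, r t (b t) ≤ n := by
    simpa using sum_le_sum fun t (ht : t ∈ range n) => hr1 t (mem_range.1 ht) (b t) (hb t)
  rw [sum_sub_distrib]
  set G := ∑ t ∈ range n, r t (b t)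
  set E := ∑ t ∈ range n, mean (playLaw (exp3S P hP γ a h0.le h1.le ha.le) r t) (r t)
  set c : ℝ := ((#{t ∈ range n | b' t ≠ b' (t + 1)} : ℕ) : ℝ)
  set l := Real.log (#P / a)
  -- There are at most `S - 1` switches; the remaining unit of `S` pays for the initial deficit `log
  -- K`.
  have hQ : Real.log #P + c * l ≤ S * l := by nlinarith
  have h3 : γ / #P * G ≤ γ / #P / (1 - γ) * E + n * (γ ^ 2 / #P / (1 - γ))
      + (S * l + n * (Real.exp 1 * a)) := by linarith
  have h4 : (1 - γ) * G ≤ E + n * γ + (1 - γ) * (#P / γ * (S * l + n * (Real.exp 1 * a))) := by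
    have := mul_le_mul_of_nonneg_left h3 (show 0 ≤ #P / γ * (1 - γ) by positivity)
    calc (1 - γ) * G = #P / γ * (1 - γ) * (γ / #P * G) := by field_simp
      _ ≤ _ := this
      _ = _ := by field_simp
  have hQ0 : 0 ≤ #P / γ * (S * l + n * (Real.exp 1 * a)) := by
    have : 0 ≤ l := hlog0.trans hlog
    positivity
  nlinarith

/-- Regret of tuned Exp3.S against a comparison sequence of hardness at most `S`, over at most
as many rounds as it is tuned to. -/
theorem sum_sub_mean_exp3STuned_le [DecidableEq X] (hP : P.Nonempty) {r : ℕ → X → ℝ}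
    {b : ℕ → X} {n S T : ℕ} (hT : 1 ≤ T) (hn : n ≤ T) (hb : ∀ t, b t ∈ P)
    (hS : hardness b n ≤ S)
    (hr0 : ∀ t < n, ∀ x ∈ P, 0 ≤ r t x) (hr1 : ∀ t < n, ∀ x ∈ P, r t x ≤ 1) :
    ∑ t ∈ range n, (r t (b t) - mean (playLaw (exp3STuned P hP S T) r t) (r t))
      ≤ 3 * √((#P : ℝ) * (S * Real.log (#P * T) + Real.exp 1) * T) := by
  have hK1 : (1 : ℝ) ≤ #P := by exact_mod_cast hP.card_pos
  have hT1 : (1 : ℝ) ≤ T := by exact_mod_cast hT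
  have hnT : (n : ℝ) ≤ T := by exact_mod_cast hn
  have he : 0 < Real.exp 1 - 1 := by linarith [Real.exp_one_gt_d9]
  have hlog : 0 ≤ Real.log (#P * T) := Real.log_nonneg (by nlinarith)
  set Q := (S : ℝ) * Real.log (#P * T) + Real.exp 1 with hQ
  have hQ0 : 0 < Q := by positivity
  set s := √((#P : ℝ) * Q * T) with hs
  set v := √(Real.exp 1 - 1) with hv
  have hv2 : v ^ 2 = Real.exp 1 - 1 := Real.sq_sqrt he.le
  have hv1 : 1 ≤ v := Real.one_le_sqrt.2 (by linarith [Real.exp_one_gt_d9])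
  have hv3 : v ≤ 2 := by nlinarith [Real.exp_one_lt_d9]
  have hs2 : s ^ 2 = #P * Q * T := Real.sq_sqrt (by positivity)
  have hspos : 0 < s := Real.sqrt_pos.2 (by positivity)
  have hrate : √((#P : ℝ) * Q / ((Real.exp 1 - 1) * T)) = s / (v * T) := by
    rw [show (#P : ℝ) * Q / ((Real.exp 1 - 1) * T) = (s / (v * T)) ^ 2 by
      rw [div_pow, hs2, mul_pow, hv2]; field_simp]
    exact Real.sqrt_sq (by positivity)
  by_cases hg : s / (v * T) < 1
  · have hγ : exp3Rate #P S T = s / (v * T) := by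
      rw [exp3Rate, hrate, min_eq_right hg.le]
    have h0 : 0 < exp3Rate #P S T := by rw [hγ]; positivity
    have h1 : exp3Rate #P S T < 1 := by rw [hγ]; exact hg
    have key := sum_sub_mean_exp3S_le hP h0 h1 (a := 1 / (T : ℝ)) (by positivity)
      (by rw [div_le_one (by positivity)]; exact hT1) hb hS hr0 hr1
    refine key.trans ?_
    rw [hγ]
    have e1 : (#P : ℝ) / (1 / (T : ℝ)) = #P * T := by field_simp
    have e2 : (n : ℝ) * (Real.exp 1 * (1 / (T : ℝ))) ≤ Real.exp 1 := by
      rw [mul_one_div, ← mul_div_assoc, div_le_iff₀ (by positivity), mul_comm]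
      gcongr
    rw [e1]
    calc 2 * (s / (v * T) * n) + #P / (s / (v * T)) * (S * Real.log (#P * T)
          + n * (Real.exp 1 * (1 / (T : ℝ))))
        ≤ 2 * (s / (v * T) * T) + #P / (s / (v * T)) * Q := by rw [hQ]; gcongr
      _ = 2 * (s / v) + (#P * Q * T) * v / s := by field_simp
      _ = (2 / v + v) * s := by rw [← hs2]; field_simp
      -- `2 / v + v ≤ 3` is `(v - 1) (v - 2) ≤ 0`, and `v = √(e - 1)` lies between `1` and `2`.
      _ ≤ 3 * s := by
        gcongr
        rw [div_add' _ _ _ (by positivity), div_le_iff₀ (by positivity)]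
        nlinarith
  -- Here the rate is capped at `1`; then `T ≤ s`, so bounding the regret by the number of rounds is
  -- enough.
  · have hsT : (T : ℝ) ≤ s := by
      rw [not_lt, le_div_iff₀ (by positivity)] at hg
      nlinarith
    have hle : ∀ t ∈ range n,
        r t (b t) - mean (playLaw (exp3STuned P hP S T) r t) (r t) ≤ 1 := by
      intro t ht
      have h2 := hr1 t (mem_range.1 ht) (b t) (hb t)
      have : 0 ≤ mean (playLaw (exp3STuned P hP S T) r t) (r t) := mean_nonneg fun x hx =>
        hr0 t (mem_range.1 ht) x (playLaw_exp3STuned_support_subset P hP S T r t hx)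
      linarith
    have := sum_le_sum hle
    simp only [sum_const, card_range, nsmul_eq_mul, mul_one] at this
    linarith

end Exp3

/-! ## Discretization -/

theorem card_strategySet_le {k d : ℕ} (A : Finset (Fin d → Fin k)) (M : ℕ) :
    #(strategySet A M) ≤ #A * M ^ k := by
  refine card_image_le.trans ?_
  simp [card_product, Fintype.card_piFinset]

theorem strategySet_subset_cube {k d : ℕ} {A : Finset (Fin d → Fin k)} {M : ℕ}
    {p : Fin d → ℝ} (hp : p ∈ strategySet A M) : p ∈ cube (Fin d) := by
  simp only [strategySet, mem_image, mem_product, Fintype.mem_piFinset, Finset.mem_Icc,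
    Prod.exists] at hp
  obtain ⟨h, c, ⟨_, hc⟩, rfl⟩ := hp
  intro l
  refine ⟨by positivity, div_le_one_of_le₀ ?_ (by positivity)⟩
  exact_mod_cast (hc (h l)).2

/-- A map that is bijective on the active coordinates puts each of them in its own part, so each can
be rounded up to the grid separately. -/
theorem exists_strategy_near {k d : ℕ} {A : Finset (Fin d → Fin k)}
    (hA : PartitionAssumption A) {M : ℕ} (hM : 1 ≤ M) {xs : Fin d → ℝ}
    (hxs : xs ∈ cube (Fin d)) (i : Fin k ↪ Fin d) :
    ∃ p ∈ strategySet A M, ∀ l, |xs (i l) - p (i l)| ≤ 1 / (M : ℝ) := by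
  obtain ⟨h, hh, hbij⟩ := hA i
  choose σ hσ hσu using hbij
  have hM0 : (0 : ℝ) < M := by exact_mod_cast hM
  -- `σ` inverts `h` on the active coordinates. The maximum with `1` matters only at the coordinate
  -- value `0`, since the grid starts at `1 / M`.
  refine ⟨fun l => ((max 1 ⌈(M : ℝ) * xs (i (σ (h l)))⌉₊ : ℕ) : ℝ) / M, ?_, fun l => ?_⟩
  · simp only [strategySet, mem_image, mem_product, Fintype.mem_piFinset, Finset.mem_Icc,
      Prod.exists]
    refine ⟨h, fun j => max 1 ⌈(M : ℝ) * xs (i (σ j))⌉₊, ⟨hh, fun j => ⟨le_max_left _ _, ?_⟩⟩, rfl⟩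
    refine max_le hM (Nat.ceil_le.2 ?_)
    have := (hxs (i (σ j))).2
    nlinarith
  · have e : σ (h (i l)) = l := (hσu (h (i l)) l rfl).symm
    simp only [e]
    have hx := hxs (i l)
    set x := xs (i l)
    have h0 : 0 ≤ (M : ℝ) * x := mul_nonneg hM0.le hx.1
    have h1 : (M : ℝ) * x ≤ ((max 1 ⌈(M : ℝ) * x⌉₊ : ℕ) : ℝ) := by
      push_cast
      exact (Nat.le_ceil _).trans (le_max_right _ _)
    have h2 : ((max 1 ⌈(M : ℝ) * x⌉₊ : ℕ) : ℝ) ≤ (M : ℝ) * x + 1 := by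
      push_cast
      exact max_le (by linarith) (Nat.ceil_lt_add_one h0).le
    set c := ((max 1 ⌈(M : ℝ) * x⌉₊ : ℕ) : ℝ)
    have e2 : x - c / M = -((c - M * x) / M) := by field_simp; ring
    rw [e2, abs_neg, abs_of_nonneg (div_nonneg (by linarith) hM0.le)]
    gcongr
    linarith

/-- For values in `[0,1]` the local condition becomes global at the price of a larger constant:
beyond distance `δ`, the difference is at most `1 = δ^(-α) δ^α`. -/
theorem sub_le_of_near {α L δ : ℝ} (hα : 0 < α) (hδ : 0 < δ) {k : ℕ}
    {f : (Fin k → ℝ) → ℝ} (hf : LocallyHolder α L δ f)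
    (hf1 : ∀ u ∈ cube (Fin k), f u ∈ Set.Icc (0 : ℝ) 1) {u v : Fin k → ℝ}
    (hu : u ∈ cube (Fin k)) (hv : v ∈ cube (Fin k)) {η : ℝ} (hη : 0 ≤ η)
    (huv : ∀ l, |u l - v l| ≤ η) :
    f u - f v ≤ max L (δ ^ (-α)) * (√(k : ℝ) * η) ^ α := by
  have hn : ‖(WithLp.toLp 2 (u - v) : EuclideanSpace ℝ (Fin k))‖ ≤ √(k : ℝ) * η := by
    rw [EuclideanSpace.norm_eq]
    refine Real.sqrt_le_iff.2 ⟨by positivity, ?_⟩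
    rw [mul_pow, Real.sq_sqrt (by positivity)]
    calc _ ≤ ∑ _l : Fin k, η ^ 2 := by
          refine sum_le_sum fun l _ => ?_
          have := huv l
          simp only [Pi.sub_apply, Real.norm_eq_abs]
          gcongr
      _ = _ := by simp
  set ν := ‖(WithLp.toLp 2 (u - v) : EuclideanSpace ℝ (Fin k))‖ with hν
  have hν0 : 0 ≤ ν := norm_nonneg _
  by_cases h : ν ≤ δ
  · calc f u - f v ≤ |f u - f v| := le_abs_self _
      _ ≤ L * ν ^ α := hf u hu v hv h
      _ ≤ _ := by
        have := le_max_left L (δ ^ (-α))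
        gcongr
  · push Not at h
    calc f u - f v ≤ 1 := by linarith [(hf1 u hu).2, (hf1 v hv).1]
      _ = δ ^ (-α) * δ ^ α := by rw [← Real.rpow_add hδ]; simp
      _ ≤ _ := by
        have := le_max_right L (δ ^ (-α))
        have := h.le.trans hn
        gcongr

/-! ## Regret over an epoch, before tuning the grid -/

theorem regret_eq {X : Type} {π : Policy X} {r : ℕ → X → ℝ}
    (hfin : ∀ t, (playLaw π r t).support.Finite) (n : ℕ) (xs : X) :
    regret π r n xs = ∑ t ∈ range n, (r t xs - mean (playLaw π r t) (r t)) := by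
  refine sum_congr rfl fun t _ => ?_
  have := mean_sub (hfin t) (fun _ => r t xs) (r t)
  rw [mean_const] at this
  exact this

/-- Transfers the hardness of the active tuples to the comparison arms chosen from them. -/
theorem hardness_comp_le {B B' : Type} (φ : B → B') (b : ℕ → B) (n : ℕ) :
    hardness (fun t => φ (b t)) n ≤ hardness b n := by
  classical
  unfold hardness
  gcongr 1 + ?_
  refine card_le_card fun l hl => ?_
  simp only [mem_filter] at hl ⊢
  exact ⟨hl.1, fun h => hl.2 (by rw [h])⟩

theorem reward_mem_Icc {α L δ : ℝ} {k d n : ℕ} {g : ℕ → (Fin k → ℝ) → ℝ}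
    (hg : Admissible α L δ n g) (i : ℕ → (Fin k ↪ Fin d)) {t : ℕ} (ht : t < n) {x : Fin d → ℝ}
    (hx : x ∈ cube (Fin d)) : reward g i t x ∈ Set.Icc (0 : ℝ) 1 :=
  (hg t ht).1 _ fun _ => hx _

theorem regret_exp3STuned_le_rounds {α L δ : ℝ} {k d n : ℕ} {A : Finset (Fin d → Fin k)}
    {M : ℕ} (hP : (strategySet A M).Nonempty) (S T : ℕ) {g : ℕ → (Fin k → ℝ) → ℝ}
    {i : ℕ → (Fin k ↪ Fin d)} (hg : Admissible α L δ n g)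
    {xs : Fin d → ℝ} (hxs : xs ∈ cube (Fin d)) :
    regret (exp3STuned (strategySet A M) hP S T) (reward g i) n xs ≤ n := by
  have hfin := fun t => (strategySet A M).finite_toSet.subset
    (playLaw_exp3STuned_support_subset _ hP S T (reward g i) t)
  rw [regret_eq hfin]
  refine (sum_le_sum (g := fun _ => (1 : ℝ)) fun t ht => ?_).trans (by simp)
  have h1 := (reward_mem_Icc hg i (mem_range.1 ht) hxs).2
  have h2 : 0 ≤ mean (playLaw (exp3STuned (strategySet A M) hP S T) (reward g i) t)
      (reward g i t) := mean_nonneg fun x hx =>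
    (reward_mem_Icc hg i (mem_range.1 ht) (strategySet_subset_cube
      (playLaw_exp3STuned_support_subset _ hP S T (reward g i) t hx))).1
  linarith

theorem regret_exp3STuned_le {α L δ : ℝ} (hα : 0 < α) (hδ : 0 < δ) {k d n : ℕ}
    {A : Finset (Fin d → Fin k)} (hA : PartitionAssumption A) {M : ℕ} (hM : 1 ≤ M)
    (hP : (strategySet A M).Nonempty) {S T : ℕ} (hT : 1 ≤ T) (hn : n ≤ T)
    {g : ℕ → (Fin k → ℝ) → ℝ} {i : ℕ → (Fin k ↪ Fin d)} (hg : Admissible α L δ n g)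
    (hi : hardness i n ≤ S) {xs : Fin d → ℝ} (hxs : xs ∈ cube (Fin d)) :
    regret (exp3STuned (strategySet A M) hP S T) (reward g i) n xs
      ≤ T * (max L (δ ^ (-α)) * (√(k : ℝ) * (1 / (M : ℝ))) ^ α)
        + 3 * √((#(strategySet A M) : ℝ)
          * (S * Real.log (#(strategySet A M) * T) + Real.exp 1) * T) := by
  have hfin := fun t => (strategySet A M).finite_toSet.subset
    (playLaw_exp3STuned_support_subset _ hP S T (reward g i) t)
  rw [regret_eq hfin]
  choose φ hφ hφx using fun e => exists_strategy_near hA hM hxs e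
  have hr : ∀ t < n, ∀ x ∈ strategySet A M, reward g i t x ∈ Set.Icc (0 : ℝ) 1 :=
    fun t ht x hx => reward_mem_Icc hg i ht (strategySet_subset_cube hx)
  have h1 := sum_sub_mean_exp3STuned_le hP (r := reward g i) (b := fun t => φ (i t)) hT hn
    (fun t => hφ _) ((hardness_comp_le φ i n).trans hi) (fun t ht x hx => (hr t ht x hx).1)
    (fun t ht x hx => (hr t ht x hx).2)
  have h2 : ∑ t ∈ range n, (reward g i t xs - reward g i t (φ (i t)))
      ≤ T * (max L (δ ^ (-α)) * (√(k : ℝ) * (1 / (M : ℝ))) ^ α) := by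
    have : ∀ t ∈ range n, reward g i t xs - reward g i t (φ (i t))
        ≤ max L (δ ^ (-α)) * (√(k : ℝ) * (1 / (M : ℝ))) ^ α := fun t ht =>
      sub_le_of_near hα hδ (hg t (mem_range.1 ht)).2 (hg t (mem_range.1 ht)).1
        (fun _ => hxs _) (fun _ => strategySet_subset_cube (hφ _) _) (by positivity)
        (fun l => hφx _ l)
    refine (sum_le_sum this).trans ?_
    rw [sum_const, card_range, nsmul_eq_mul]
    gcongr
  calc _ = ∑ t ∈ range n, (reward g i t xs - reward g i t (φ (i t)))
        + ∑ t ∈ range n, (reward g i t (φ (i t))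
          - mean (playLaw (exp3STuned (strategySet A M) hP S T) (reward g i) t)
            (reward g i t)) := by
        rw [← sum_add_distrib]
        exact sum_congr rfl fun t _ => by ring
    _ ≤ _ := add_le_add h2 h1

/-! ## Tuning the grid -/

/-- The real number whose ceiling is the number of grid values. -/
noncomputable def gridReal (α : ℝ) (k d S T : ℕ) : ℝ :=
  ((k : ℝ) ^ ((α - 3) / 2) * Real.exp (-(k : ℝ) / 2)
    * ((S : ℝ) * Real.log (d : ℝ)) ^ (-(1 / 2) : ℝ)
    * √((T : ℝ) / Real.log (T : ℝ))) ^ (2 / (2 * α + (k : ℝ)))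

theorem gridSize_eq (α : ℝ) (k d S T : ℕ) : gridSize α k d S T = max 1 ⌈gridReal α k d S T⌉₊ :=
  rfl

theorem log_two_le_log_natCast {d : ℕ} (hd : 2 ≤ d) : Real.log 2 ≤ Real.log d :=
  Real.log_le_log two_pos (by exact_mod_cast hd)

theorem neg_log_two_le_log {x : ℝ} (hx : Real.log 2 ≤ x) : -Real.log 2 ≤ Real.log x := by
  rw [← Real.log_inv]
  refine Real.log_le_log (by norm_num) ?_
  linarith [Real.log_two_gt_d9]

section Tuning

variable {α : ℝ} {k d S T : ℕ}

theorem log_natCast_pos (hd : 2 ≤ d) : 0 < Real.log d :=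
  Real.log_pos (by exact_mod_cast hd)

theorem gridReal_pos (hk : 1 ≤ k) (hd : 2 ≤ d) (hS : 1 ≤ S) (hT : 2 ≤ T) :
    0 < gridReal α k d S T := by
  have h1 := log_natCast_pos hd
  have h2 := log_natCast_pos hT
  have h3 : (0 : ℝ) < k := by exact_mod_cast hk
  have h4 : (0 : ℝ) < S := by exact_mod_cast hS
  have h5 : (0 : ℝ) < T := by positivity
  unfold gridReal
  positivity

theorem regretBound_pos (hk : 1 ≤ k) (hd : 2 ≤ d) (hS : 1 ≤ S) (hT : 2 ≤ T) :
    0 < regretBound α k d S T := by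
  have h1 := log_natCast_pos hd
  have h2 := log_natCast_pos hT
  have h3 : (0 : ℝ) < k := by exact_mod_cast hk
  have h4 : (0 : ℝ) < S := by exact_mod_cast hS
  have h5 : (0 : ℝ) < T := by positivity
  unfold regretBound
  positivity

theorem log_gridReal (hk : 1 ≤ k) (hd : 2 ≤ d) (hS : 1 ≤ S) (hT : 2 ≤ T) :
    Real.log (gridReal α k d S T)
      = ((α - 3) * Real.log k - k - Real.log (S * Real.log d)
        + (Real.log T - Real.log (Real.log T))) / (2 * α + k) := by
  have h1 := log_natCast_pos hd
  have h2 := log_natCast_pos hT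
  have h3 : (0 : ℝ) < k := by exact_mod_cast hk
  have h4 : (0 : ℝ) < S := by exact_mod_cast hS
  have h5 : (0 : ℝ) < T := by positivity
  have h6 : (0 : ℝ) < S * Real.log d := by positivity
  unfold gridReal
  rw [Real.log_rpow (by positivity), Real.log_mul (by positivity) (by positivity),
    Real.log_mul (by positivity) (by positivity), Real.log_mul (by positivity) (by positivity),
    Real.log_rpow h3, Real.log_exp, Real.log_rpow h6, Real.log_sqrt (by positivity),
    Real.log_div h5.ne' h2.ne']
  ring

theorem log_regretBound (hk : 1 ≤ k) (hd : 2 ≤ d) (hS : 1 ≤ S) (hT : 2 ≤ T) :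
    Real.log (regretBound α k d S T)
      = (α + k) / (2 * α + k) * Real.log T + α / (2 * α + k) * Real.log (Real.log T)
        + α * (k + 6) / (2 * (2 * α + k)) * Real.log k
        + α / (2 * α + k) * Real.log (S * Real.log d) := by
  have h1 := log_natCast_pos hd
  have h2 := log_natCast_pos hT
  have h3 : (0 : ℝ) < k := by exact_mod_cast hk
  have h4 : (0 : ℝ) < S := by exact_mod_cast hS
  have h5 : (0 : ℝ) < T := by positivity
  have h6 : (0 : ℝ) < S * Real.log d := by positivity
  unfold regretBound
  rw [Real.log_mul (by positivity) (by positivity), Real.log_mul (by positivity) (by positivity),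
    Real.log_mul (by positivity) (by positivity), Real.log_rpow h5, Real.log_rpow h2,
    Real.log_rpow h3, Real.log_rpow h6]

/-- Both sides are positive, and their logarithms are linear combinations of the same quantities;
comparing coefficients proves the identity. -/
theorem discretization_eq (hα : 0 < α) (hk : 1 ≤ k) (hd : 2 ≤ d) (hS : 1 ≤ S) (hT : 2 ≤ T) :
    T * (√(k : ℝ) / gridReal α k d S T) ^ α
      = Real.exp (k * α / (2 * α + k)) * regretBound α k d S T := by
  have hY := gridReal_pos (α := α) hk hd hS hT
  have hB := regretBound_pos (α := α) hk hd hS hT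
  have h3 : (0 : ℝ) < k := by exact_mod_cast hk
  have h5 : (0 : ℝ) < T := by positivity
  refine Real.log_injOn_pos (Set.mem_Ioi.2 (by positivity)) (Set.mem_Ioi.2 (by positivity)) ?_
  rw [Real.log_mul h5.ne' (by positivity), Real.log_rpow (by positivity),
    Real.log_div (by positivity) hY.ne', Real.log_sqrt h3.le,
    Real.log_mul (Real.exp_ne_zero _) hB.ne', Real.log_exp, log_gridReal hk hd hS hT,
    log_regretBound hk hd hS hT]
  field_simp
  ring

/-- The counterpart that justifies the choice of `gridReal`. The leading factor `k` is slack,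
dropped in `estimation_le`. -/
theorem estimation_eq (hα : 0 < α) (hk : 1 ≤ k) (hd : 2 ≤ d) (hS : 1 ≤ S) (hT : 2 ≤ T) :
    k * √(k * Real.exp k * (S * Real.log d) * (T * Real.log T) * gridReal α k d S T ^ k)
      = Real.exp (k * α / (2 * α + k)) * regretBound α k d S T := by
  have hY := gridReal_pos (α := α) hk hd hS hT
  have hB := regretBound_pos (α := α) hk hd hS hT
  have h1 := log_natCast_pos hd
  have h2 := log_natCast_pos hT
  have h3 : (0 : ℝ) < k := by exact_mod_cast hk
  have h4 : (0 : ℝ) < S := by exact_mod_cast hS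
  have h5 : (0 : ℝ) < T := by positivity
  have h6 : (0 : ℝ) < S * Real.log d := by positivity
  refine Real.log_injOn_pos (Set.mem_Ioi.2 (by positivity)) (Set.mem_Ioi.2 (by positivity)) ?_
  rw [Real.log_mul h3.ne' (by positivity), Real.log_sqrt (by positivity),
    Real.log_mul (by positivity) (by positivity), Real.log_mul (by positivity) (by positivity),
    Real.log_mul (by positivity) h6.ne', Real.log_mul h3.ne' (by positivity), Real.log_exp,
    Real.log_mul h5.ne' h2.ne', Real.log_pow,
    Real.log_mul (Real.exp_ne_zero _) hB.ne', Real.log_exp, log_gridReal hk hd hS hT,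
    log_regretBound hk hd hS hT]
  generalize Real.log (S * Real.log d) = l
  field_simp
  ring

theorem exp_ratio_le (hα : 0 < α) (hα1 : α ≤ 1) (k : ℕ) :
    Real.exp (k * α / (2 * α + k)) ≤ Real.exp 1 := by
  refine Real.exp_le_exp.2 ?_
  have : (0 : ℝ) ≤ k := by positivity
  rw [div_le_one (by positivity)]
  nlinarith

/-- On a large time scale the grid is fine enough for rounding to cost only a constant. -/
theorem half_le_gridReal (hα : 0 < α) (hα1 : α ≤ 1) (hk : 1 ≤ k) (hd : 2 ≤ d) (hS : 1 ≤ S)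
    (hT : 2 ≤ T)
    (hlarge : (k : ℝ) ^ (k + 5) * Real.exp k * ((S : ℝ) * Real.log d)
      ≤ 2 ^ k * ((T : ℝ) / Real.log T)) :
    (k : ℝ) / 2 ≤ gridReal α k d S T := by
  have hY := gridReal_pos (α := α) hk hd hS hT
  have h1 := log_natCast_pos hd
  have h2 := log_natCast_pos hT
  have h3 : (0 : ℝ) < k := by exact_mod_cast hk
  have h4 : (0 : ℝ) < S := by exact_mod_cast hS
  have h5 : (0 : ℝ) < T := by positivity
  have h6 : (0 : ℝ) < S * Real.log d := by positivity
  have h7 : 0 ≤ Real.log k := Real.log_natCast_nonneg k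
  have h8 : 0 ≤ Real.log 2 := Real.log_nonneg one_le_two
  have hl := Real.log_le_log (by positivity) hlarge
  rw [Real.log_mul (by positivity) h6.ne', Real.log_mul (by positivity) (by positivity),
    Real.log_pow, Real.log_exp, Real.log_mul (x := 2 ^ k) (by positivity) (by positivity),
    Real.log_pow, Real.log_div h5.ne' h2.ne'] at hl
  push_cast at hl
  rw [← Real.log_le_log_iff (by positivity) hY, Real.log_div h3.ne' two_ne_zero,
    log_gridReal hk hd hS hT, le_div_iff₀ (by positivity)]
  -- The factor `2^k` in the hypothesis is absorbed by the `2` in `k / 2`; what remains is `0 ≤ (2 -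
  -- α) log k + 2 α log 2`.
  nlinarith [mul_nonneg hα.le h8, mul_nonneg (show 0 ≤ 2 - α by linarith) h7]

/-- The logarithm of the number of arms is of the order of `log T`. -/
theorem log_arms_mul_le (hα : 0 < α) (hα1 : α ≤ 1) (hk : 1 ≤ k) (hd : 2 ≤ d) (hS : 1 ≤ S)
    (hT : 2 ≤ T) {c K : ℝ} (hc : 1 ≤ c) (hK1 : 1 ≤ K)
    (hK : K ≤ c * (k * Real.exp k * Real.log d) * (2 * gridReal α k d S T) ^ k)
    (hY1 : 1 ≤ gridReal α k d S T) :
    Real.log (K * T) ≤ (2 * Real.log c + 6) * Real.log T := by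
  have hY := gridReal_pos (α := α) hk hd hS hT
  have h1 := log_natCast_pos hd
  have h2 := log_natCast_pos hT
  have h3 : (0 : ℝ) < k := by exact_mod_cast hk
  have h4 : (1 : ℝ) ≤ S := by exact_mod_cast hS
  have h5 : (0 : ℝ) < T := by positivity
  have h7 : 0 ≤ Real.log k := Real.log_natCast_nonneg k
  have h8 : 0 ≤ Real.log 2 := Real.log_nonneg one_le_two
  have h9 : 0 ≤ Real.log c := Real.log_nonneg hc
  have h10 : 0 ≤ Real.log S := Real.log_nonneg h4
  have hT2 := log_two_le_log_natCast hT
  have hd2 := log_two_le_log_natCast hd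
  have hllT := neg_log_two_le_log hT2
  have hlld := neg_log_two_le_log hd2
  have hl := Real.log_le_log (by positivity) hK
  rw [Real.log_mul (by positivity) (by positivity), Real.log_mul (by positivity) (by positivity),
    Real.log_mul (by positivity) (by positivity), Real.log_mul (by positivity) (by positivity),
    Real.log_exp, Real.log_pow, Real.log_mul two_ne_zero hY.ne'] at hl
  have hlY : 0 ≤ Real.log (gridReal α k d S T) := Real.log_nonneg hY1
  -- The terms `k` and `log (log d)` here cancel those coming from the size of the family.
  have hkY : k * Real.log (gridReal α k d S T)
      ≤ (α - 3) * Real.log k - k - (Real.log S + Real.log (Real.log d))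
        + (Real.log T - Real.log (Real.log T)) := by
    rw [← Real.log_mul (by positivity) h1.ne']
    calc _ ≤ (2 * α + k) * Real.log (gridReal α k d S T) := by nlinarith
      _ = _ := by rw [log_gridReal hk hd hS hT]; field_simp
  -- As `Y ≤ e` may happen, this bound on `k` comes from the right side of `log_gridReal` being
  -- nonnegative, not from `k log Y`.
  have hk3 : (k : ℝ) ≤ 3 * Real.log T := by nlinarith
  have hk2 : k * Real.log 2 ≤ k := by nlinarith [Real.log_two_lt_d9]
  have hlog2 := Real.log_two_gt_d9
  rw [Real.log_mul (by positivity) h5.ne']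
  have : Real.log K ≤ Real.log c + 5 * Real.log T := by nlinarith
  nlinarith

/-- `M ≤ Y + 1 = (1 + 1 / Y) Y`. The parameter `f` is the price of rounding after the square root is
taken; it is set to `2^(k/2)` or to `e` later. -/
theorem gridSize_pow_le (f : ℝ) (hY1 : 1 ≤ gridReal α k d S T)
    (hf : (1 + 1 / gridReal α k d S T) ^ k ≤ f ^ 2) :
    (gridSize α k d S T : ℝ) ^ k ≤ f ^ 2 * gridReal α k d S T ^ k := by
  set Y := gridReal α k d S T
  have hM : (gridSize α k d S T : ℝ) ≤ (1 + 1 / Y) * Y := by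
    rw [gridSize_eq, add_mul, one_div_mul_cancel (by positivity)]
    push_cast
    exact max_le (by linarith) (by linarith [Nat.ceil_lt_add_one (show 0 ≤ Y by positivity)])
  calc (gridSize α k d S T : ℝ) ^ k ≤ ((1 + 1 / Y) * Y) ^ k := by gcongr
    _ = (1 + 1 / Y) ^ k * Y ^ k := mul_pow _ _ _
    _ ≤ _ := by gcongr

theorem estimation_le (hα : 0 < α) (hα1 : α ≤ 1) (hk : 1 ≤ k) (hd : 2 ≤ d) (hS : 1 ≤ S)
    (hT : 2 ≤ T) {c K f : ℝ} (hc : 1 ≤ c) (hK1 : 1 ≤ K)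
    (hK : K ≤ c * (k * Real.exp k * Real.log d) * gridSize α k d S T ^ k)
    (hY1 : 1 ≤ gridReal α k d S T) (hf0 : 0 ≤ f)
    (hf : (1 + 1 / gridReal α k d S T) ^ k ≤ f ^ 2) :
    √(K * (S * Real.log (K * T) + Real.exp 1) * T)
      ≤ √(c * (2 * Real.log c + 12)) * f * (Real.exp 1 * regretBound α k d S T) := by
  have h1 := log_natCast_pos hd
  have h2 := log_natCast_pos hT
  have h3 : (1 : ℝ) ≤ k := by exact_mod_cast hk
  have h4 : (1 : ℝ) ≤ S := by exact_mod_cast hS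
  have h5 : (0 : ℝ) < T := by positivity
  have h9 : 0 ≤ Real.log c := Real.log_nonneg hc
  have hB := regretBound_pos (α := α) hk hd hS hT
  have hest := estimation_eq hα hk hd hS hT
  have hexp := exp_ratio_le hα hα1 k
  have hlog : Real.log (K * T) ≤ (2 * Real.log c + 6) * Real.log T := by
    refine log_arms_mul_le hα hα1 hk hd hS hT hc hK1 (hK.trans ?_) hY1
    have : (gridSize α k d S T : ℝ) ≤ 2 * gridReal α k d S T := by
      rw [gridSize_eq]
      push_cast
      exact max_le (by linarith) (by
        linarith [Nat.ceil_lt_add_one (show 0 ≤ gridReal α k d S T by linarith)])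
    gcongr
  have hM := gridSize_pow_le f hY1 hf
  have hY := gridReal_pos (α := α) hk hd hS hT
  set Y := gridReal α k d S T
  have hQ : S * Real.log (K * T) + Real.exp 1 ≤ (2 * Real.log c + 12) * (S * Real.log T) := by
    have hT2 := log_two_le_log_natCast hT
    have e1 : Real.exp 1 ≤ 6 * (S * Real.log T) := by
      nlinarith [Real.exp_one_lt_d9, Real.log_two_gt_d9]
    nlinarith
  have hQ0 : 0 ≤ S * Real.log (K * T) + Real.exp 1 := by
    have : 0 ≤ Real.log (K * T) := Real.log_nonneg (by
      have : (1 : ℝ) ≤ T := by exact_mod_cast (by omega : 1 ≤ T)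
      nlinarith)
    positivity
  have hle : K * (S * Real.log (K * T) + Real.exp 1) * T
      ≤ c * (2 * Real.log c + 12) * f ^ 2
        * (k * Real.exp k * (S * Real.log d) * (T * Real.log T) * Y ^ k) := by
    calc _ ≤ c * (k * Real.exp k * Real.log d) * (f ^ 2 * Y ^ k)
          * ((2 * Real.log c + 12) * (S * Real.log T)) * T := by
          gcongr
          exact hK.trans (by gcongr)
      _ = _ := by ring
  refine (Real.sqrt_le_sqrt hle).trans ?_
  rw [Real.sqrt_mul (by positivity), Real.sqrt_mul (by positivity), Real.sqrt_sq hf0]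
  gcongr
  calc _ ≤ k * √(k * Real.exp k * (S * Real.log d) * (T * Real.log T) * Y ^ k) :=
        le_mul_of_one_le_left (Real.sqrt_nonneg _) h3
    _ = _ := hest
    _ ≤ _ := by gcongr

theorem discretization_le (hα : 0 < α) (hα1 : α ≤ 1) (hk : 1 ≤ k) (hd : 2 ≤ d) (hS : 1 ≤ S)
    (hT : 2 ≤ T) :
    T * (√(k : ℝ) / gridReal α k d S T) ^ α ≤ Real.exp 1 * regretBound α k d S T := by
  have := exp_ratio_le hα hα1 k
  have := (regretBound_pos (α := α) hk hd hS hT).le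
  rw [discretization_eq hα hk hd hS hT]
  gcongr

end Tuning

/-- Regret over an initial part of an epoch, with respect to any point of the cube. -/
theorem exists_regret_epochPolicy_le {α : ℝ} (L : ℝ) {δ : ℝ} (c₀ : ℝ) (hα : 0 < α) (hα1 : α ≤ 1)
    (hδ : 0 < δ) :
    ∃ C : ℝ, 1 ≤ C ∧ ∀ k d S : ℕ, 1 ≤ k → 2 ≤ d → 1 ≤ S →
      ∀ (A : Finset (Fin d → Fin k)) (hA : A.Nonempty), PartitionAssumption A →
      (#A : ℝ) ≤ c₀ * (k * Real.exp k * Real.log d) →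
      ∀ (T n : ℕ), 2 ≤ T → n ≤ T → ∀ (g : ℕ → (Fin k → ℝ) → ℝ) (i : ℕ → (Fin k ↪ Fin d))
        (xs : Fin d → ℝ), Admissible α L δ n g → hardness i n ≤ S → xs ∈ cube (Fin d) →
        regret (epochPolicy α A hA S T) (reward g i) n xs
            ≤ C * 2 ^ ((k : ℝ) / 2) * regretBound α k d S T ∧
        ((k : ℝ) ^ (k + 5) * Real.exp k * ((S : ℝ) * Real.log d)
            ≤ 2 ^ k * ((T : ℝ) / Real.log T) →
          regret (epochPolicy α A hA S T) (reward g i) n xs ≤ C * regretBound α k d S T) := by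
  set D := max L (δ ^ (-α)) with hD
  have hD0 : 0 ≤ D := le_max_of_le_right (by positivity)
  -- Ensures `log c ≥ 0`, since `c₀` is arbitrary.
  set c := max c₀ 1 with hc
  have hc1 : 1 ≤ c := le_max_right _ _
  set V := √(c * (2 * Real.log c + 12)) with hV
  have hV0 : 0 ≤ V := Real.sqrt_nonneg _
  have he1 : 1 ≤ Real.exp 1 := Real.one_le_exp zero_le_one
  -- The summand `1` serves the case `Y < 1`, `D` the discretization and the last summand the
  -- estimation, its inner `e` being the rounding price for `Y ≥ k / 2`.
  refine ⟨Real.exp 1 * (1 + D + 3 * V * Real.exp 1), ?_, ?_⟩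
  · nlinarith [mul_nonneg hV0 (Real.exp_pos 1).le]
  intro k d S hk hd hS A hA hpart hcard T n hT hn g i xs hg hi hxs
  have hY := gridReal_pos (α := α) hk hd hS hT
  have hB := regretBound_pos (α := α) hk hd hS hT
  have hdisc := discretization_le hα hα1 hk hd hS hT
  have h1 := log_natCast_pos hd
  have h3 : (1 : ℝ) ≤ k := by exact_mod_cast hk
  have h5 : (0 : ℝ) < T := by positivity
  have hM1 : 1 ≤ gridSize α k d S T := le_max_left _ _
  have hP : (strategySet A (gridSize α k d S T)).Nonempty := strategySet_nonempty hA hM1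
  have hMY : gridReal α k d S T ≤ gridSize α k d S T := by
    rw [gridSize_eq]
    push_cast
    exact (Nat.le_ceil _).trans (le_max_right _ _)
  have h2k : (1 : ℝ) ≤ 2 ^ ((k : ℝ) / 2) := Real.one_le_rpow one_le_two (by positivity)
  have triv : regret (epochPolicy α A hA S T) (reward g i) n xs ≤ T :=
    (regret_exp3STuned_le_rounds hP S T hg hxs).trans (by exact_mod_cast hn)
  have main := regret_exp3STuned_le hα hδ hpart hM1 hP (by omega) hn hg hi hxs
  set R := regret (epochPolicy α A hA S T) (reward g i) n xs with hR
  change R ≤ _ at main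
  set B := regretBound α k d S T
  set Y := gridReal α k d S T with hYdef
  -- With `Y < 1`, the number of rounds `T` is already below `T (√k / Y)^α`, which `hdisc` bounds.
  by_cases hY1 : Y < 1
  · have hRB : R ≤ Real.exp 1 * B := by
      refine triv.trans (le_trans ?_ hdisc)
      refine le_mul_of_one_le_right h5.le (Real.one_le_rpow ?_ hα.le)
      rw [le_div_iff₀ hY]
      have : 1 ≤ √(k : ℝ) := Real.one_le_sqrt.2 h3
      linarith
    have hRC : R ≤ Real.exp 1 * (1 + D + 3 * V * Real.exp 1) * B := by
      refine hRB.trans ?_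
      have : 1 ≤ 1 + D + 3 * V * Real.exp 1 := by
        have : 0 ≤ 3 * V * Real.exp 1 := by positivity
        linarith
      gcongr
      exact le_mul_of_one_le_right (Real.exp_pos 1).le this
    refine ⟨hRC.trans ?_, fun _ => hRC⟩
    exact mul_le_mul_of_nonneg_right (le_mul_of_one_le_right (by positivity) h2k) hB.le
  · push Not at hY1
    have hK1 : (1 : ℝ) ≤ #(strategySet A (gridSize α k d S T)) := by
      exact_mod_cast hP.card_pos
    have hK : (#(strategySet A (gridSize α k d S T)) : ℝ)
        ≤ c * (k * Real.exp k * Real.log d) * gridSize α k d S T ^ k := by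
      calc (#(strategySet A (gridSize α k d S T)) : ℝ)
          ≤ #A * gridSize α k d S T ^ k := by exact_mod_cast card_strategySet_le A _
        _ ≤ _ := by
          have : c₀ ≤ c := le_max_left _ _
          gcongr
          exact hcard.trans (by gcongr)
    have key : ∀ f : ℝ, 0 ≤ f → (1 + 1 / Y) ^ k ≤ f ^ 2 →
        R ≤ D * (Real.exp 1 * B) + 3 * (V * f * (Real.exp 1 * B)) := by
      intro f hf0 hf
      refine main.trans (add_le_add ?_ ?_)
      · calc _ ≤ T * (D * (√(k : ℝ) / Y) ^ α) := by
              rw [mul_one_div]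
              gcongr
          _ = D * (T * (√(k : ℝ) / Y) ^ α) := by ring
          _ ≤ _ := by gcongr
      · gcongr
        exact estimation_le hα hα1 hk hd hS hT hc1 hK1 hK hY1 hf0 hf
    have h1Y : 1 / Y ≤ 1 := by rw [div_le_one hY]; exact hY1
    constructor
    · refine (key (2 ^ ((k : ℝ) / 2)) (by positivity) ?_).trans ?_
      · rw [← Real.rpow_natCast, ← Real.rpow_natCast, ← Real.rpow_mul zero_le_two]
        push_cast
        rw [div_mul_cancel₀ _ two_ne_zero]
        gcongr
        linarith
      · have e1 : D * (Real.exp 1 * B) ≤ D * (Real.exp 1 * B) * 2 ^ ((k : ℝ) / 2) :=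
          le_mul_of_one_le_right (by positivity) h2k
        have e2 : V * 2 ^ ((k : ℝ) / 2) * (Real.exp 1 * B)
            ≤ V * 2 ^ ((k : ℝ) / 2) * (Real.exp 1 * B) * Real.exp 1 :=
          le_mul_of_one_le_right (by positivity) he1
        have e3 : 0 ≤ 2 ^ ((k : ℝ) / 2) * (Real.exp 1 * B) := by positivity
        nlinarith
    · intro hlarge
      -- Hence `(1 + 1 / Y)^k ≤ e^(k / Y) ≤ e²`.
      have hkY := half_le_gridReal hα hα1 hk hd hS hT hlarge
      refine (key (Real.exp 1) (by positivity) ?_).trans ?_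
      · calc (1 + 1 / Y) ^ k ≤ Real.exp (1 / Y) ^ k := by
              gcongr
              linarith [Real.add_one_le_exp (1 / Y)]
          _ = Real.exp (k * (1 / Y)) := (Real.exp_nat_mul _ _).symm
          _ ≤ Real.exp ((2 : ℕ) * 1) := by
              refine Real.exp_le_exp.2 ?_
              rw [mul_one_div, div_le_iff₀ hY]
              push_cast
              linarith
          _ = _ := Real.exp_nat_mul _ _
      · have : 0 ≤ Real.exp 1 * B := by positivity
        nlinarith

/-! ## The doubling trick -/

/-- Cuts the rounds into dyadic blocks. Truncated subtraction shortens the last block and makes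
those beyond `n` empty. -/
theorem sum_range_min_two_pow (f : ℕ → ℝ) (n m : ℕ) :
    ∑ t ∈ range (min n (2 ^ m - 1)), f t
      = ∑ j ∈ range m, ∑ s ∈ range (min (2 ^ j) (n - (2 ^ j - 1))), f (2 ^ j - 1 + s) := by
  induction m with
  | zero => simp
  | succ m ih =>
    have h1 : 1 ≤ 2 ^ m := Nat.one_le_two_pow
    have h2 : 2 ^ (m + 1) = 2 * 2 ^ m := by ring
    rw [sum_range_succ, ← ih]
    by_cases h : n ≤ 2 ^ m - 1
    · rw [min_eq_left (by omega), min_eq_left h, Nat.sub_eq_zero_of_le h]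
      simp
    · rw [show min n (2 ^ (m + 1) - 1) = (2 ^ m - 1) + min (2 ^ m) (n - (2 ^ m - 1)) by omega,
        sum_range_add, show min n (2 ^ m - 1) = 2 ^ m - 1 by omega]

theorem cabPolicy_eq_epochPolicy (α : ℝ) {k d : ℕ} {A : Finset (Fin d → Fin k)} (hA : A.Nonempty)
    (S m : ℕ) {h : List ((Fin d → ℝ) × ℝ)} (h1 : 2 ^ m - 1 ≤ h.length)
    (h2 : h.length < 2 ^ m - 1 + 2 ^ m) :
    cabPolicy α A hA S h = epochPolicy α A hA S (2 ^ m) (h.drop (2 ^ m - 1)) := by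
  have h3 : 1 ≤ 2 ^ m := Nat.one_le_two_pow
  have hlog : Nat.log 2 (h.length + 1) = m :=
    (Nat.log_eq_iff (Or.inr ⟨by norm_num, by omega⟩)).2 ⟨by omega, by rw [pow_succ]; omega⟩
  simp only [cabPolicy, hlog]

/-- The same `xs` appears in every epoch and need not be optimal there, and the last epoch may be
cut short; hence `exists_regret_epochPolicy_le` allows any point of the cube and any `n ≤ T`. -/
theorem regret_cabPolicy_eq (α : ℝ) {k d : ℕ} {A : Finset (Fin d → Fin k)} (hA : A.Nonempty)
    (S : ℕ) (r : ℕ → (Fin d → ℝ) → ℝ) (n : ℕ) (xs : Fin d → ℝ) :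
    regret (cabPolicy α A hA S) r n xs
      = ∑ m ∈ range (Nat.log 2 n + 1), regret (epochPolicy α A hA S (2 ^ m))
          (fun t => r (2 ^ m - 1 + t)) (min (2 ^ m) (n - (2 ^ m - 1))) xs := by
  have hn : n < 2 ^ (Nat.log 2 n + 1) := Nat.lt_pow_succ_log_self (by norm_num) n
  unfold regret
  conv_lhs => rw [show n = min n (2 ^ (Nat.log 2 n + 1) - 1) by omega]
  rw [sum_range_min_two_pow]
  refine sum_congr rfl fun m _ => sum_congr rfl fun s hs => ?_
  rw [playLaw_add (fun h h1 h2 => cabPolicy_eq_epochPolicy α hA S m h1 h2) r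
    ((mem_range.1 hs).trans_le (min_le_left _ _))]

theorem hardness_shift_le {B : Type} (b : ℕ → B) {N l n : ℕ} (h : N + l ≤ n) :
    hardness (fun t => b (N + t)) l ≤ hardness b n := by
  classical
  unfold hardness
  gcongr 1 + ?_
  refine card_le_card_of_injOn (fun t => N + t) (fun t ht => ?_) fun x _ y _ hxy => by
    simpa using hxy
  simp only [coe_filter, mem_range, Set.mem_ofPred_eq] at ht ⊢
  exact ⟨by omega, ht.2⟩

theorem Admissible.shift {α L δ : ℝ} {k n N l : ℕ} {g : ℕ → (Fin k → ℝ) → ℝ}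
    (hg : Admissible α L δ n g) (h : N + l ≤ n) : Admissible α L δ l fun t => g (N + t) :=
  fun t ht => hg (N + t) (by omega)

/-- The exponent of `T` is at least `2/3` because `α ≤ 1 ≤ k`; the logarithmic factor is monotone.
-/
theorem regretBound_le_ratio {α : ℝ} (hα : 0 < α) (hα1 : α ≤ 1) {k d S T n : ℕ} (hk : 1 ≤ k)
    (hd : 2 ≤ d) (hT : 2 ≤ T) (hn : T ≤ n) :
    regretBound α k d S T ≤ ((T : ℝ) / n) ^ (2 / 3 : ℝ) * regretBound α k d S n := by
  have h1 := log_natCast_pos hd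
  have h2 := log_natCast_pos hT
  have h3 : (1 : ℝ) ≤ k := by exact_mod_cast hk
  have h5 : (0 : ℝ) < T := by positivity
  have hTn : (T : ℝ) ≤ n := by exact_mod_cast hn
  have hn0 : (0 : ℝ) < n := h5.trans_le hTn
  have hρ : (2 : ℝ) / 3 ≤ (α + k) / (2 * α + k) := by
    rw [div_le_div_iff₀ (by norm_num) (by positivity)]
    linarith
  have e1 : (T : ℝ) ^ ((α + k) / (2 * α + k))
      ≤ (T / n : ℝ) ^ (2 / 3 : ℝ) * (n : ℝ) ^ ((α + k) / (2 * α + k)) := by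
    calc (T : ℝ) ^ ((α + k) / (2 * α + k))
        = (T / n : ℝ) ^ ((α + k) / (2 * α + k)) * (n : ℝ) ^ ((α + k) / (2 * α + k)) := by
          rw [← Real.mul_rpow (by positivity) hn0.le, div_mul_cancel₀ _ hn0.ne']
      _ ≤ _ := mul_le_mul_of_nonneg_right (Real.rpow_le_rpow_of_exponent_ge (by positivity)
          ((div_le_one hn0).2 hTn) hρ) (by positivity)
  have e2 : Real.log T ^ (α / (2 * α + k)) ≤ Real.log n ^ (α / (2 * α + k)) := by
    gcongr
  unfold regretBound
  rw [← mul_assoc, ← mul_assoc, ← mul_assoc]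
  gcongr

/-- Rests on `1/2 ≤ (9/10)^6`. -/
theorem ratio_rpow_le {m q n : ℕ} (hm : m ≤ q) (hq : 2 ^ q ≤ n) :
    (((2 ^ m : ℕ) : ℝ) / n) ^ (1 / 6 : ℝ) ≤ (9 / 10 : ℝ) ^ (q - m) := by
  have hq' : (2 : ℝ) ^ q ≤ n := by exact_mod_cast hq
  have e1 : ((2 ^ m : ℕ) : ℝ) / n ≤ ((9 / 10 : ℝ) ^ (q - m)) ^ 6 := by
    calc ((2 ^ m : ℕ) : ℝ) / n ≤ 2 ^ m / 2 ^ q := by push_cast; gcongr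
      _ = (1 / 2) ^ (q - m) := by
        obtain ⟨j, rfl⟩ := Nat.exists_eq_add_of_le hm
        rw [Nat.add_sub_cancel_left, pow_add, one_div, inv_pow]
        field_simp
      _ ≤ ((9 / 10) ^ 6) ^ (q - m) := by gcongr; norm_num
      _ = _ := pow_right_comm _ _ _
  calc _ ≤ (((9 / 10 : ℝ) ^ (q - m)) ^ 6) ^ (1 / 6 : ℝ) := by gcongr
    _ = _ := by
      rw [← Real.rpow_natCast _ 6, ← Real.rpow_mul (by positivity)]
      norm_num

/-- Absorbs the single round of the epoch `T = 1`, where `regretBound` vanishes. The two logarithmic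
factors are each at least `1/2`, the others at least `1`. -/
theorem one_le_four_mul_regretBound {α : ℝ} (hα : 0 < α) {k d S n : ℕ} (hk : 1 ≤ k)
    (hd : 2 ≤ d) (hS : 1 ≤ S) (hn : 2 ≤ n) : 1 ≤ 4 * regretBound α k d S n := by
  have h3 : (1 : ℝ) ≤ k := by exact_mod_cast hk
  have h4 : (1 : ℝ) ≤ S := by exact_mod_cast hS
  have h5 : (1 : ℝ) ≤ n := by exact_mod_cast (by omega : 1 ≤ n)
  have hβ0 : 0 ≤ α / (2 * α + k) := by positivity
  have hβ : α / (2 * α + k) ≤ 1 := by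
    rw [div_le_one (by positivity)]
    linarith
  have half : ∀ x : ℝ, Real.log 2 ≤ x → 1 / 2 ≤ x ^ (α / (2 * α + k)) := fun x hx => by
    calc (1 / 2 : ℝ) = (1 / 2) ^ (1 : ℝ) := by norm_num
      _ ≤ (1 / 2) ^ (α / (2 * α + k)) :=
        Real.rpow_le_rpow_of_exponent_ge (by norm_num) (by norm_num) hβ
      _ ≤ _ := Real.rpow_le_rpow (by norm_num) (by linarith [Real.log_two_gt_d9]) hβ0
  have e1 := half _ (log_two_le_log_natCast hn)
  have e2 := half ((S : ℝ) * Real.log d) (by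
    have := log_two_le_log_natCast hd
    have := log_natCast_pos hd
    nlinarith)
  have e3 : 1 ≤ (n : ℝ) ^ ((α + k) / (2 * α + k)) := Real.one_le_rpow h5 (by positivity)
  have e4 : 1 ≤ (k : ℝ) ^ (α * (k + 6) / (2 * (2 * α + k))) :=
    Real.one_le_rpow h3 (by positivity)
  have : (1 : ℝ) * (1 / 2) * 1 * (1 / 2) ≤ regretBound α k d S n := by
    unfold regretBound
    gcongr
  linarith

theorem sum_range_le_of_geometric {n q : ℕ} {R : ℕ → ℝ} {E : ℝ} (hE : 0 ≤ E)
    (h0 : R 0 ≤ n) (hR : ∀ m, 1 ≤ m → m ≤ q → R m ≤ E * (9 / 10) ^ (q - m)) :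
    ∑ m ∈ range (q + 1), R m ≤ n + 10 * E := by
  have geom : ∑ j ∈ range q, (9 / 10 : ℝ) ^ j ≤ 10 := by
    rw [geom_sum_eq (by norm_num), div_le_iff_of_neg (by norm_num)]
    have : (0 : ℝ) ≤ (9 / 10) ^ q := by positivity
    linarith
  rw [sum_range_succ', add_comm]
  refine add_le_add h0 ?_
  calc ∑ m ∈ range q, R (m + 1) ≤ ∑ m ∈ range q, E * (9 / 10) ^ (q - 1 - m) := by
        refine sum_le_sum fun m hm => ?_
        have := hR (m + 1) (by omega) (by have := mem_range.1 hm; omega)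
        rwa [show q - (m + 1) = q - 1 - m by omega] at this
    _ = E * ∑ j ∈ range q, (9 / 10 : ℝ) ^ j := by
        rw [← mul_sum, sum_range_reflect (fun j => (9 / 10 : ℝ) ^ j)]
    _ ≤ E * 10 := by gcongr
    _ = _ := by ring

theorem exists_regret_le {α : ℝ} (L : ℝ) {δ : ℝ} (c₀ : ℝ) (hα : 0 < α) (hα1 : α ≤ 1)
    (hδ : 0 < δ) :
    ∃ C : ℝ, 0 < C ∧ ∀ k d S : ℕ, 1 ≤ k → 2 ≤ d → 1 ≤ S →
      ∀ (A : Finset (Fin d → Fin k)) (hA : A.Nonempty), PartitionAssumption A →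
      (#A : ℝ) ≤ c₀ * (k * Real.exp k * Real.log d) →
        (∀ T : ℕ, 2 ≤ T →
          RegretAtMost α L δ k S T (epochPolicy α A hA S T)
            (C * (2 : ℝ) ^ ((k : ℝ) / 2) * regretBound α k d S T) ∧
          (IsLarge k d S T →
            RegretAtMost α L δ k S T (epochPolicy α A hA S T) (C * regretBound α k d S T))) ∧
        (∀ n : ℕ, 2 ≤ n →
          RegretAtMost α L δ k S n (cabPolicy α A hA S)
            (C * (2 : ℝ) ^ ((k : ℝ) / 2) * regretBound α k d S n) ∧
          (IsLarge k d S n →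
            RegretAtMost α L δ k S n (cabPolicy α A hA S) (C * regretBound α k d S n))) := by
  obtain ⟨C, hC, hepoch⟩ := exists_regret_epochPolicy_le L c₀ hα hα1 hδ
  -- `4` for the first epoch and `10` for the geometric series of ratio `9/10`.
  refine ⟨14 * C, by positivity, fun k d S hk hd hS A hA hpart hcard => ⟨fun T hT => ?_,
    fun n hn => ?_⟩⟩
  · have hB := regretBound_pos (α := α) hk hd hS hT
    have key := fun g i xs hg hi hxs =>
      hepoch k d S hk hd hS A hA hpart hcard T T hT le_rfl g i xs hg hi hxs
    refine ⟨fun g i xs hg hi hxs => (key g i xs hg hi hxs.1).1.trans ?_,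
      fun hl g i xs hg hi hxs => ((key g i xs hg hi hxs.1).2 ?_).trans ?_⟩
    · gcongr; linarith
    · refine hl.trans (le_mul_of_one_le_left ?_ (one_le_pow₀ one_le_two))
      exact div_nonneg (by positivity) (log_natCast_pos hT).le
    · gcongr; linarith
  · have hB := regretBound_pos (α := α) hk hd hS hn
    have hB1 := one_le_four_mul_regretBound hα hk hd hS hn
    have h2k : (1 : ℝ) ≤ 2 ^ ((k : ℝ) / 2) := Real.one_le_rpow one_le_two (by positivity)
    set q := Nat.log 2 n with hq
    have hqn : 2 ^ q ≤ n := Nat.pow_log_le_self 2 (by omega)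
    have hn0 : (0 : ℝ) < n := by positivity
    have first : ∀ g i xs, Admissible α L δ n g → xs ∈ cube (Fin d) →
        regret (epochPolicy α A hA S (2 ^ 0)) (fun t => reward g i (2 ^ 0 - 1 + t))
          (min (2 ^ 0) (n - (2 ^ 0 - 1))) xs ≤ (1 : ℕ) := fun g i xs hg hxs =>
      (regret_exp3STuned_le_rounds (strategySet_nonempty hA (le_max_left _ _)) S _
        (i := fun t => i (2 ^ 0 - 1 + t))
        (hg.shift (show 2 ^ 0 - 1 + min (2 ^ 0) (n - (2 ^ 0 - 1)) ≤ n by omega)) hxs).trans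
        (by exact_mod_cast min_le_left _ _)
    have later : ∀ g i xs, Admissible α L δ n g → hardness i n ≤ S → xs ∈ cube (Fin d) →
        ∀ m, 1 ≤ m → m ≤ q → _ := fun g i xs hg hi hxs m hm hmq =>
      have h2m : 2 ^ m ≤ n := (Nat.pow_le_pow_right (by norm_num) hmq).trans hqn
      have hle : 2 ^ m - 1 + min (2 ^ m) (n - (2 ^ m - 1)) ≤ n := by omega
      hepoch k d S hk hd hS A hA hpart hcard (2 ^ m) (min (2 ^ m) (n - (2 ^ m - 1)))
        (Nat.le_self_pow (by omega) 2) (min_le_left _ _) (fun t => g (2 ^ m - 1 + t))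
        (fun t => i (2 ^ m - 1 + t)) xs (hg.shift hle) ((hardness_shift_le i hle).trans hi) hxs
    have ratio : ∀ m, 1 ≤ m → m ≤ q → 0 < ((2 ^ m : ℕ) : ℝ) / n ∧ ((2 ^ m : ℕ) : ℝ) / n ≤ 1 ∧
        regretBound α k d S (2 ^ m)
          ≤ (((2 ^ m : ℕ) : ℝ) / n) ^ (2 / 3 : ℝ) * regretBound α k d S n := by
      intro m hm hmq
      have h2m : 2 ^ m ≤ n := (Nat.pow_le_pow_right (by norm_num) hmq).trans hqn
      have h2m' : ((2 ^ m : ℕ) : ℝ) ≤ n := by exact_mod_cast h2m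
      exact ⟨by positivity, (div_le_one hn0).2 h2m',
        regretBound_le_ratio hα hα1 hk hd (Nat.le_self_pow (by omega) 2) h2m⟩
    have small : ∀ m, 1 ≤ m → m ≤ q →
        regretBound α k d S (2 ^ m) ≤ regretBound α k d S n * (9 / 10) ^ (q - m) := by
      intro m hm hmq
      obtain ⟨r0, r1, hr⟩ := ratio m hm hmq
      rw [mul_comm]
      refine hr.trans (mul_le_mul_of_nonneg_right (le_trans ?_ (ratio_rpow_le hmq hqn)) hB.le)
      exact Real.rpow_le_rpow_of_exponent_ge r0 r1 (by norm_num)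
    refine ⟨fun g i xs hg hi hxs => ?_, fun hl g i xs hg hi hxs => ?_⟩
    · rw [regret_cabPolicy_eq]
      refine (sum_range_le_of_geometric (E := C * 2 ^ ((k : ℝ) / 2) * regretBound α k d S n)
        (by positivity) (first g i xs hg hxs.1) fun m hm hmq =>
          (later g i xs hg hi hxs.1 m hm hmq).1.trans ?_).trans ?_
      · rw [mul_assoc _ (regretBound α k d S n)]
        gcongr
        exact small m hm hmq
      · have : regretBound α k d S n ≤ C * 2 ^ ((k : ℝ) / 2) * regretBound α k d S n :=
          le_mul_of_one_le_left hB.le (by nlinarith)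
        push_cast
        linarith
    · rw [regret_cabPolicy_eq]
      refine (sum_range_le_of_geometric (E := C * regretBound α k d S n)
        (by positivity) (first g i xs hg hxs.1) fun m hm hmq => ?_).trans ?_
      · have hl' := later g i xs hg hi hxs.1 m hm hmq
        -- A long epoch inherits largeness from `n` up to the factor `2^k`, as its logarithm is no
        -- larger. In a short one `2^(k/2) (2^m / n)^(1/2) ≤ 1`, so the weaker bound suffices.
        by_cases hmk : (n : ℝ) ≤ 2 ^ k * ((2 ^ m : ℕ) : ℝ)
        · refine (hl'.2 ?_).trans ?_
          · refine (show _ ≤ _ from hl).trans ?_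
            have h1 := log_natCast_pos (show 2 ≤ 2 ^ m from Nat.le_self_pow (by omega) 2)
            have h2 : ((2 ^ m : ℕ) : ℝ) ≤ n := (div_le_one hn0).1 (ratio m hm hmq).2.1
            rw [← mul_div_assoc]
            gcongr
          · rw [mul_assoc _ (regretBound α k d S n)]
            gcongr
            exact small m hm hmq
        · push Not at hmk
          refine hl'.1.trans ?_
          obtain ⟨r0, r1, hr⟩ := ratio m hm hmq
          set x := ((2 ^ m : ℕ) : ℝ) / n with hx
          have hkx : (2 : ℝ) ^ ((k : ℝ) / 2) * x ^ (1 / 2 : ℝ) ≤ 1 := by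
            have e : (2 : ℝ) ^ ((k : ℝ) / 2) = ((2 : ℝ) ^ k) ^ (1 / 2 : ℝ) := by
              rw [← Real.rpow_natCast, ← Real.rpow_mul zero_le_two, mul_one_div]
            rw [e, ← Real.mul_rpow (by positivity) r0.le]
            refine Real.rpow_le_one (by positivity) ?_ (by norm_num)
            rw [hx, ← mul_div_assoc, div_le_one hn0]
            exact hmk.le
          have hx6 : x ^ (2 / 3 : ℝ) = x ^ (1 / 2 : ℝ) * x ^ (1 / 6 : ℝ) := by
            rw [← Real.rpow_add r0]; norm_num
          calc C * 2 ^ ((k : ℝ) / 2) * regretBound α k d S (2 ^ m)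
              ≤ C * 2 ^ ((k : ℝ) / 2) * (x ^ (2 / 3 : ℝ) * regretBound α k d S n) := by gcongr
            _ = C * regretBound α k d S n
                * ((2 ^ ((k : ℝ) / 2) * x ^ (1 / 2 : ℝ)) * x ^ (1 / 6 : ℝ)) := by
              rw [hx6]; ring
            _ ≤ C * regretBound α k d S n * (1 * (9 / 10) ^ (q - m)) := by
              gcongr
              exact ratio_rpow_le hmq hqn
            _ = _ := by ring
      · have : regretBound α k d S n ≤ C * regretBound α k d S n :=
          le_mul_of_one_le_left hB.le hC
        push_cast
        linarith

/-! ## The random family of partitions -/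

/-- The maps `h` that are one-to-one on the coordinates `i`. -/
def Separates {k d : ℕ} (i : Fin k ↪ Fin d) (h : Fin d → Fin k) : Prop :=
  Function.Bijective fun l => h (i l)

/-- `k^k / k!` is one term of the exponential series of `e^k`. -/
theorem exp_neg_le_factorial_div (k : ℕ) : Real.exp (-k) * (k : ℝ) ^ k ≤ k.factorial := by
  have h := Real.pow_div_factorial_le_exp (k : ℝ) (by positivity) k
  rw [div_le_iff₀ (by positivity)] at h
  rw [Real.exp_neg, inv_mul_le_iff₀ (Real.exp_pos _)]
  exact h

open Classical in
/-- A uniformly random map separates `k` given coordinates with probability at least `e^(-k)`. -/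
theorem card_separates {k d : ℕ} (i : Fin k ↪ Fin d) :
    Real.exp (-k) * (Fintype.card (Fin d → Fin k) : ℝ)
      ≤ (#{h : Fin d → Fin k | Separates i h} : ℝ) := by
  set R := {l : Fin d // ¬ l ∈ Set.range i}
  -- Splits a map into its values on the chosen coordinates, reindexed by `Fin k`, and the rest.
  -- Separation means that the first component is a permutation.
  let e : (Fin d → Fin k) ≃ (Fin k → Fin k) × (R → Fin k) :=
    (Equiv.piEquivPiSubtypeProd (fun l => l ∈ Set.range i) fun _ => Fin k).trans
      (Equiv.prodCongr (Equiv.arrowCongr (Equiv.ofInjective i i.injective).symm (Equiv.refl _))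
        (Equiv.refl _))
  have he : ∀ h l, (e h).1 l = h (i l) := fun h l => rfl
  have hcard : Fintype.card (Fin d → Fin k) = k ^ k * Fintype.card (R → Fin k) := by
    rw [Fintype.card_congr e, Fintype.card_prod]
    simp
  have hle : k.factorial * Fintype.card (R → Fin k) ≤ #{h : Fin d → Fin k | Separates i h} := by
    have : k.factorial * Fintype.card (R → Fin k)
        = #(univ : Finset (Equiv.Perm (Fin k) × (R → Fin k))) := by
      rw [card_univ, Fintype.card_prod, Fintype.card_perm, Fintype.card_fin]
    rw [this]
    refine card_le_card_of_injOn (fun p => e.symm (p.1, p.2)) (fun p _ => ?_) fun p _ q _ h => ?_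
    · rw [mem_coe, mem_filter]
      refine ⟨mem_univ _, ?_⟩
      simp only [Separates, ← he, Equiv.apply_symm_apply]
      exact p.1.bijective
    · have := e.symm.injective h
      simp only [Prod.mk.injEq, DFunLike.coe_fn_eq] at this
      exact Prod.ext this.1 this.2
  rw [hcard]
  calc _ = Real.exp (-k) * (k : ℝ) ^ k * Fintype.card (R → Fin k) := by push_cast; ring
    _ ≤ k.factorial * Fintype.card (R → Fin k) := by
      gcongr
      exact exp_neg_le_factorial_div k
    _ ≤ _ := by exact_mod_cast hle

open Classical in
-- Independence makes the failures a product set, and `1 - x ≤ e^(-x)` bounds each factor.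
theorem card_forall_not_separates {k d : ℕ} (N : ℕ) (i : Fin k ↪ Fin d) :
    (#{ω : Fin N → Fin d → Fin k | ∀ a, ¬ Separates i (ω a)} : ℝ)
      ≤ Real.exp (-(N * Real.exp (-k))) * Fintype.card (Fin N → Fin d → Fin k) := by
  have e1 : ({ω : Fin N → Fin d → Fin k | ∀ a, ¬ Separates i (ω a)} : Finset _)
      = Fintype.piFinset fun _ => {h : Fin d → Fin k | ¬ Separates i h} := by
    ext ω
    simp [Fintype.mem_piFinset]
  have e2 : (#{h : Fin d → Fin k | ¬ Separates i h} : ℝ)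
      ≤ Real.exp (-Real.exp (-k)) * Fintype.card (Fin d → Fin k) := by
    have h1 := card_separates i
    have h2 : (#{h : Fin d → Fin k | Separates i h} : ℝ)
        + #{h : Fin d → Fin k | ¬ Separates i h} = Fintype.card (Fin d → Fin k) := by
      exact_mod_cast card_filter_add_card_filter_not (s := univ) (Separates i)
    have h3 := Real.add_one_le_exp (-Real.exp (-k))
    have h4 : (0 : ℝ) ≤ Fintype.card (Fin d → Fin k) := by positivity
    nlinarith
  rw [e1, Fintype.card_piFinset, prod_const, card_univ, Fintype.card_fin]
  push_cast
  calc _ ≤ (Real.exp (-Real.exp (-k)) * Fintype.card (Fin d → Fin k)) ^ N := by gcongr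
    _ = _ := by
      rw [mul_pow, ← Real.exp_nat_mul, Fintype.card_fun (α := Fin N), Fintype.card_fin]
      push_cast
      ring_nf

/-- Lets the ceiling in `familySize` be absorbed when the constant `2` is raised to `3`. -/
theorem one_le_entropy {k d : ℕ} (hk : 1 ≤ k) (hd : 2 ≤ d) :
    1 ≤ k * Real.exp k * Real.log d := by
  have h1 : (1 : ℝ) ≤ k := by exact_mod_cast hk
  have h2 := Real.add_one_le_exp (k : ℝ)
  have h3 := log_two_le_log_natCast hd
  have h4 := Real.log_two_gt_d9
  calc (1 : ℝ) ≤ 1 * 2 * (1 / 2) := by norm_num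
    _ ≤ _ := by gcongr <;> linarith

open Classical in
theorem uniformOn_univ_real {Ω : Type} [Fintype Ω] [MeasurableSpace Ω]
    [MeasurableSingletonClass Ω] (s : Set Ω) :
    (ProbabilityTheory.uniformOn (Set.univ : Set Ω)).real s
      = (#{ω | ω ∈ s} : ℝ) / ((Fintype.card Ω : ℕ) : ℝ) := by
  have h : s.encard = ((#{ω | ω ∈ s} : ℕ) : ℕ∞) := by
    rw [← Set.encard_coe_eq_coe_finsetCard]
    simp
  rw [MeasureTheory.measureReal_def, ProbabilityTheory.uniformOn_univ, ENNReal.toReal_div,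
    MeasureTheory.Measure.count_apply s.toFinite.measurableSet, h]
  simp

theorem partitionAssumption_image_probability {k d : ℕ} (hk : 1 ≤ k) (hd : 2 ≤ d) :
    1 - ((d : ℝ) ^ k)⁻¹ ≤
      (ProbabilityTheory.uniformOn
        (Set.univ : Set (Fin (familySize k d) → Fin d → Fin k))).real
        {ω | PartitionAssumption (Finset.univ.image ω) ∧
          ((Finset.univ.image ω).card : ℝ) ≤ 3 * (k * Real.exp k * Real.log d)} := by
  classical
  have hent := one_le_entropy hk hd
  have hkpos : 0 < k := hk
  have : Nonempty (Fin k) := ⟨⟨0, hkpos⟩⟩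
  have hd0 : (0 : ℝ) < d := by positivity
  set N := familySize k d with hN
  have hNle : (N : ℝ) ≤ 3 * (k * Real.exp k * Real.log d) := by
    have := (Nat.ceil_lt_add_one
      (show 0 ≤ 2 * (k : ℝ) * Real.exp k * Real.log d by linarith)).le
    rw [hN, familySize]
    linarith
  have hNge : 2 * (k : ℝ) * Real.exp k * Real.log d ≤ N := Nat.le_ceil _
  set good := {ω : Fin N → Fin d → Fin k | PartitionAssumption (Finset.univ.image ω) ∧
    ((Finset.univ.image ω).card : ℝ) ≤ 3 * (k * Real.exp k * Real.log d)}
  set W : ℝ := ((Fintype.card (Fin N → Fin d → Fin k) : ℕ) : ℝ) with hW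
  have hW0 : 0 < W := by rw [hW]; exact_mod_cast Fintype.card_pos
  have hreal : (ProbabilityTheory.uniformOn (Set.univ : Set (Fin N → Fin d → Fin k))).real good
      = (#{ω | ω ∈ good} : ℝ) / W := by
    convert uniformOn_univ_real good
  have hbad : (#{ω | ω ∉ good} : ℝ) ≤ ((d : ℝ) ^ k)⁻¹ * W := by
    have hsub : ({ω | ω ∉ good} : Finset (Fin N → Fin d → Fin k))
        ⊆ (univ : Finset (Fin k ↪ Fin d)).biUnion
          fun i => {ω | ∀ a, ¬ Separates i (ω a)} := by
      intro ω hω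
      simp only [mem_filter, mem_univ, true_and, mem_biUnion] at hω ⊢
      by_contra hno
      push Not at hno
      refine hω ⟨fun i => ?_, le_trans ?_ hNle⟩
      · obtain ⟨a, ha⟩ := hno i
        exact ⟨ω a, mem_image_of_mem _ (mem_univ a),
          (Function.bijective_iff_existsUnique _).1 ha⟩
      · exact_mod_cast card_image_le.trans (by simp)
    have hemb : (Fintype.card (Fin k ↪ Fin d) : ℝ) ≤ (d : ℝ) ^ k := by
      rw [Fintype.card_embedding_eq, Fintype.card_fin, Fintype.card_fin]
      exact_mod_cast Nat.descFactorial_le_pow d k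
    -- The `2` in `familySize` yields `d^(-2k)`; the union bound over tuples uses up one factor
    -- `d^(-k)`.
    have hexp : Real.exp (-(N * Real.exp (-k))) ≤ ((d : ℝ) ^ k)⁻¹ * ((d : ℝ) ^ k)⁻¹ := by
      have : 2 * k * Real.log d ≤ N * Real.exp (-k) := by
        rw [Real.exp_neg, ← div_eq_mul_inv, le_div_iff₀ (Real.exp_pos _)]
        linarith
      calc _ ≤ Real.exp (-(2 * k * Real.log d)) := Real.exp_le_exp.2 (by linarith)
        _ = ((d : ℝ) ^ k)⁻¹ * ((d : ℝ) ^ k)⁻¹ := by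
          rw [← mul_inv, ← pow_add, Real.exp_neg, ← Real.exp_log (pow_pos hd0 (k + k)),
            Real.log_pow]
          push_cast
          ring_nf
    calc (#{ω | ω ∉ good} : ℝ)
        ≤ ∑ i : Fin k ↪ Fin d, (#{ω : Fin N → Fin d → Fin k | ∀ a, ¬ Separates i (ω a)} : ℝ) := by
          exact_mod_cast (card_le_card hsub).trans card_biUnion_le
      _ ≤ ∑ _i : Fin k ↪ Fin d, ((d : ℝ) ^ k)⁻¹ * ((d : ℝ) ^ k)⁻¹ * W :=
          sum_le_sum fun i _ => (card_forall_not_separates N i).trans (by gcongr)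
      _ = Fintype.card (Fin k ↪ Fin d) * (((d : ℝ) ^ k)⁻¹ * ((d : ℝ) ^ k)⁻¹ * W) := by
          rw [sum_const, card_univ, nsmul_eq_mul]
      _ ≤ (d : ℝ) ^ k * (((d : ℝ) ^ k)⁻¹ * ((d : ℝ) ^ k)⁻¹ * W) := by gcongr
      _ = _ := by field_simp
  have hsum : (#{ω | ω ∈ good} : ℝ) + #{ω | ω ∉ good} = W := by
    rw [hW]
    exact_mod_cast card_filter_add_card_filter_not (s := univ) (· ∈ good)
  rw [hreal, le_div_iff₀ hW0]
  linarith

end ContinuumBandit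

theorem mainTheorem2 (α L δ c₀ : ℝ) (hα : 0 < α) (hα1 : α ≤ 1) (hL : 0 ≤ L) (hδ : 0 < δ) :
    ∃ C : ℝ, 0 < C ∧ ∀ k d S : ℕ, 1 ≤ k → k ≤ d → 2 ≤ d → 1 ≤ S →
      -- the random family is good with probability at least `1 - d^(-k)`
      1 - ((d : ℝ) ^ k)⁻¹ ≤
        (ProbabilityTheory.uniformOn
          (Set.univ : Set (Fin (ContinuumBandit.familySize k d) → Fin d → Fin k))).real
          {ω | ContinuumBandit.PartitionAssumption (Finset.univ.image ω) ∧
            ((Finset.univ.image ω).card : ℝ) ≤ 3 * (k * Real.exp k * Real.log d)} ∧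
      -- regret for any good family
      ∀ (A : Finset (Fin d → Fin k)) (hA : A.Nonempty),
        ContinuumBandit.PartitionAssumption A →
        (A.card : ℝ) ≤ c₀ * (k * Real.exp k * Real.log d) →
          -- one epoch of `T` rounds
          (∀ T : ℕ, 2 ≤ T →
            ContinuumBandit.RegretAtMost α L δ k S T (ContinuumBandit.epochPolicy α A hA S T)
              (C * (2 : ℝ) ^ ((k : ℝ) / 2) * ContinuumBandit.regretBound α k d S T) ∧
            (ContinuumBandit.IsLarge k d S T →
              ContinuumBandit.RegretAtMost α L δ k S T
                (ContinuumBandit.epochPolicy α A hA S T)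
                (C * ContinuumBandit.regretBound α k d S T))) ∧
          -- `n` rounds, unknown to the player
          (∀ n : ℕ, 2 ≤ n →
            ContinuumBandit.RegretAtMost α L δ k S n (ContinuumBandit.cabPolicy α A hA S)
              (C * (2 : ℝ) ^ ((k : ℝ) / 2) * ContinuumBandit.regretBound α k d S n) ∧
            (ContinuumBandit.IsLarge k d S n →
              ContinuumBandit.RegretAtMost α L δ k S n (ContinuumBandit.cabPolicy α A hA S)
                (C * ContinuumBandit.regretBound α k d S n))) := by
  obtain ⟨C, hC, h⟩ := ContinuumBandit.exists_regret_le L c₀ hα hα1 hδ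
  exact ⟨C, hC, fun k d S hk _ hd hS =>
    ⟨ContinuumBandit.partitionAssumption_image_probability hk hd, h k d S hk hd hS⟩⟩
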